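/- **Setting.** Let $D,T\ge 1$, let $\mathcal C$ be a standard Borel space, and let $\mathsf P$ be a probability measure on $\mathcal C\times\mathbb R^D$ with $\mathcal C$-marginal $\mathsf P_{\mathcal C}$ and disintegration $\mathsf P(dc,dx)=\mathsf P_{\mathcal C}(dc)\,\pi^\star(dx\mid c)$, where for $\mathsf P_{\mathcal C}$-a.e. $c$ the law $\pi^\star(\cdot\mid c)$ has a Lebesgue density $\pi^\star(x\mid c)$ (jointly measurable). Let $q_s$, $0\le s\le T-1$, be Markov kernels on $\mathbb R^D$ with strictly positive (jointly measurable) densities $q_s(x'\mid x)$, and let $\nu$ be a probability measure on $\mathbb R^D$. Put $q^{\pi^\star}(dx_{0:T}\mid c)=\pi^\star(dx_0\mid c)\prod_{s=0}^{T-1}q_s(dx_{s+1}\mid x_s)$ and $\mathsf Q=\mathsf P_{\mathcal C}(dc)\,q^{\pi^\star}(dx_{0:T}\mid c)$. Let $q^{\pi^\star}_s(\cdot\mid c)$ be the law of $X_s$ given $c$, with density $q_0^{\pi^\star}(u\mid c)=\pi^\star(u\mid c)$ and $q_s^{\pi^\star}(u\mid c)=\int q_{s-1}(u\mid v)\,q_{s-1}^{\pi^\star}(dv\mid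 c)$ for $s\ge1$. For $1\le t\le T$ let $\mathsf Q_t$ be the law of $(C,X_{t-1},X_t)$ and $(\mathsf Q_t)_{C,X_t}$ that of $(C,X_t)$ under $\mathsf Q$, and let the true reverse kernel $r_t^\star(dx_{t-1}\mid c,x_t)$ be the disintegration of $\mathsf Q_t$ over $(\mathsf Q_t)_{C,X_t}$. For each $t$ let $\phi_t:\mathcal C\times\mathbb R^D\to\mathbb R^{d_t}$ be measurable, let $F_t$ be the law of $(X_{t-1},Z_t)$ under $\mathsf Q_t$, $Z_t=\phi_t(C,X_t)$, and let $(F_t)_{Z_t}$ be the law of $Z_t$. A hypercube is axis-parallel. **Assumptions.** (A) *Features.* For each $t$ there are a compact $K_t\subset\mathbb R^{d_t}$ and a measurable $\rho_t^\star:\mathbb R^D\times K_t\to[0,\infty)$ such that $(F_t)_{Z_t}(K_t)=1$; $F_t(dy,dz)=\rho_t^\star(y\mid z)\,dy\,(F_t)_{Z_t}(dz)$; and for $(\mathsf Q_t)_{C,X_t}$-a.e. $(c,x_t)$ the law $r_t^\star(\cdot\mid c,x_t)$ has density $\rho_t^\star(\cdot\mid\phi_t(c,x_t))$. (B) *Regularity.*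 For $\mathsf P_{\mathcal C}$-a.e. $c$ the function $\pi^\star(\cdot\mid c)$ is continuous and everywhere positive. For each $0\le s\le T-1$: $u\mapsto q_s(u\mid v)$ is continuous for every $v$; for $\mathsf P_{\mathcal C}$-a.e. $c$ and every compact $K$ there is $g\in L^1(q_s^{\pi^\star}(\cdot\mid c))$ with $\sup_{u\in K}q_s(u\mid v)\le g(v)$ for all $v$; $\int\!\!\int\|y\|^2q_s^{\pi^\star}(dy\mid c)\,\mathsf P_{\mathcal C}(dc)<\infty$; and there are $r_s>0$, closed hypercubes $C_s(x)\ni x$ of side length $r_s$ and measurable $a_{s-1}:\mathbb R^D\to[0,\infty)$, $b_s:\mathbb R^D\times\mathbb R^D\to[0,\infty)$ with $\mathbb E_{\mathsf Q_{s+1}}[a_{s-1}(X_s)+b_s(X_s,X_{s+1})]<\infty$, with $$\log\frac{q_s^{\pi^\star}(x\mid c)}{\inf_{y\in C_s(x)}q_s^{\pi^\star}(y\mid c)}\le a_{s-1}(x)\quad\text{for }\mathsf P_{\mathcal C}\text{-a.e. }c\text{ and a.e. }x,$$ and with $$\log\frac{q_s(x'\mid x)}{\inf_{y\in C_s(x)}q_s(x'\mid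 y)}\le b_s(x,x')\quad\text{for a.e. }(x,x').$$ (C) *Partitions.* For each $t$ and $m\ge1$ there are given pairwise disjoint hypercubes $A_{t,1}^m,\dots,A_{t,m}^m$ of side length $h_{t,m}>0$ with centers $\mu_{t,j}^m$ (each containing any measurable part of its boundary), the remainder $A_{t,0}^m=\mathbb R^D\setminus\bigcup_{j\ge1}A_{t,j}^m$, and scales $\delta_{t,m},\sigma_{t,m},\sigma_{t,0}>0$, such that as $m\to\infty$: $h_{t,m}\to0$, $\delta_{t,m}\to0$, $\sigma_{t,m}/\delta_{t,m}\to0$, $\delta_{t,m}^{D-1}h_{t,m}/\sigma_{t,m}^D\to0$; for every $y$ the closed hypercube of side length $\delta_{t,m}$ centered at $y$ is disjoint from $A_{t,0}^m$ for all large $m$; and $(r_{t-1}/2)^D(2\pi\sigma_{t,0}^2)^{-D/2}\le2^{-(D+1)}$. (D) *Smooth log-odds.* For each $t$ there are a closed hypercube $Q_t\supset K_t$ and an integer $s_t\ge 0$ such that for all $m\ge1$ and $1\le j\le m$ the function $\Lambda_{t,j}^m(z)=\log\bigl(\int_{A_{t,j}^m}\rho_t^\star(y\mid z)\,dy\big/\int_{A_{t,0}^m}\rho_t^\star(y\mid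 z)\,dy\bigr)$ on $K_t$ extends to a $C^{s_t}$ function on a neighborhood of $Q_t$. (E) *Exact terminal matching.* $q_T^{\pi^\star}(\cdot\mid c)=\nu$ for $\mathsf P_{\mathcal C}$-a.e. $c$. **Models.** A neural reverse model $p$ consists, for each $t$, of an $m_t\ge1$ and a feed-forward ReLU network $a_t:\mathbb R^{d_t}\to\mathbb R^{m_t}$ of arbitrary depth and widths. Its reverse kernels have the densities $$p_t(y\mid c,x_t)=\sum_{j=1}^{m_t}\frac{e^{a_{t,j}(z)}\,\varphi(y;\mu_{t,j}^{m_t},\sigma_{t,m_t}^2I_D)}{1+\sum_ke^{a_{t,k}(z)}}+\frac{\varphi(y;0,\sigma_{t,0}^2I_D)}{1+\sum_ke^{a_{t,k}(z)}},\qquad z=\phi_t(c,x_t),$$ with $\varphi(\cdot;\mu,\Sigma)$ the density of $\mathcal N(\mu,\Sigma)$. The induced predictor $\pi_{p,\nu}(\cdot\mid c)$ is the $x_0$-marginal of $\nu(dx_T)\prod_{t=1}^Tp_t(dx_{t-1}\mid c,x_t)$, and $\mathcal E_{\mathrm{KL}}(\pi)=\int\mathrm{KL}(\pi^\star(\cdot\mid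 c)\,\|\,\pi(\cdot\mid c))\,\mathsf P_{\mathcal C}(dc)$. **Claim.** Under (A)–(E): (i) For all $\eta,\delta>0$ there is a neural reverse model $p$ with $\mathsf P_{\mathcal C}\bigl(\{c:\mathrm{KL}(\pi^\star(\cdot\mid c)\,\|\,\pi_{p,\nu}(\cdot\mid c))>\eta\}\bigr)\le\delta$. (ii) There exist sequences of neural reverse models $p^n$ with $\mathcal E_{\mathrm{KL}}(\pi_{p^n,\nu})\to0$, and every such sequence has a subsequence $p^{n_k}$ with $\mathrm{KL}(\pi^\star(\cdot\mid c)\,\|\,\pi_{p^{n_k},\nu}(\cdot\mid c))\to0$ as $k\to\infty$ for $\mathsf P_{\mathcal C}$-a.e. $c$. -/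

import Mathlib

open MeasureTheory ProbabilityTheory Filter Topology
open scoped NNReal ENNReal

namespace CondDiffusion

/-- Euclidean space `ℝⁿ` with its Euclidean norm and Lebesgue measure `volume`. -/
abbrev Vec (n : ℕ) := EuclideanSpace ℝ (Fin n)

/-- The closed axis-parallel hypercube with centre `x` and side length `r`. -/
def closedCube {n : ℕ} (x : Vec n) (r : ℝ) : Set (Vec n) :=
  {y | ∀ i, |y i - x i| ≤ r / 2}

/-- The open axis-parallel hypercube with centre `x` and side length `r`. -/
def openCube {n : ℕ} (x : Vec n) (r : ℝ) : Set (Vec n) :=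
  {y | ∀ i, |y i - x i| < r / 2}

section Paths

variable {C E : Type*} [MeasurableSpace C] [MeasurableSpace E]

theorem measurable_snoc (n : ℕ) :
    Measurable (fun p : (Fin (n + 1) → E) × E =>
      (Fin.snoc p.1 p.2 : Fin (n + 2) → E)) := by
  refine measurable_pi_lambda _ fun i => ?_
  refine Fin.lastCases ?_ (fun j => ?_) i
  · simpa using measurable_snd
  · simp only [Fin.snoc_castSucc]
    fun_prop

theorem measurable_cons (n : ℕ) :
    Measurable (fun p : (Fin (n + 1) → E) × E =>
      (Fin.cons p.2 p.1 : Fin (n + 2) → E)) := by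
  refine measurable_pi_lambda _ fun i => ?_
  refine Fin.cases ?_ (fun j => ?_) i
  · simpa using measurable_snd
  · simp only [Fin.cons_succ]
    fun_prop

/-- Forward path kernel: `x₀ ~ κ(· | c)`, then `x_{s+1} ~ q_s(· | x_s)` for `s = 0, …, T-1`;
the law of `(x₀, …, x_T)` given `c`. -/
noncomputable def forwardPath (κ : Kernel C E) :
    (T : ℕ) → (Fin T → Kernel E E) → Kernel C (Fin (T + 1) → E)
  | 0, _ => κ.map (fun x _ => x)
  | T + 1, q =>
      ((forwardPath κ T (fun s => q s.castSucc)).compProd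
        ((q (Fin.last T)).comap (fun p : C × (Fin (T + 1) → E) => p.2 (Fin.last T))
          (by fun_prop))).map
        (fun p => (Fin.snoc p.1 p.2 : Fin (T + 2) → E))

/-- Backward path kernel: `x_T ~ ν`, then `x_s ~ p_{s+1}(· | c, x_{s+1})` for
`s = T-1, …, 0`; the law of `(x₀, …, x_T)` given `c`.  Here `p s` stands for the reverse kernel
from time `s + 1` to time `s`. -/
noncomputable def backwardPath (ν : Measure E) :
    (T : ℕ) → (Fin T → Kernel (C × E) E) → Kernel C (Fin (T + 1) → E)
  | 0, _ => (Kernel.const C ν).map (fun x _ => x)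
  | T + 1, p =>
      ((backwardPath ν T (fun s => p s.succ)).compProd
        ((p 0).comap (fun z : C × (Fin (T + 1) → E) => (z.1, z.2 0))
          (by fun_prop))).map
        (fun z => (Fin.cons z.2 z.1 : Fin (T + 2) → E))

/-- The induced predictor `π_{p,ν}`: the `x₀`-marginal of the backward path kernel. -/
noncomputable def predictor (ν : Measure E) (T : ℕ) (p : Fin T → Kernel (C × E) E) :
    Kernel C E :=
  (backwardPath ν T p).map (fun x => x 0)

instance isMarkovKernel_forwardPath (κ : Kernel C E) [IsMarkovKernel κ] (T : ℕ)
    (q : Fin T → Kernel E E) [∀ s, IsMarkovKernel (q s)] :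
    IsMarkovKernel (forwardPath κ T q) := by
  induction T with
  | zero => exact Kernel.IsMarkovKernel.map _ (by fun_prop)
  | succ T ih =>
    have := ih (fun s => q s.castSucc)
    exact Kernel.IsMarkovKernel.map _ (measurable_snoc T)

instance isMarkovKernel_backwardPath (ν : Measure E) [IsProbabilityMeasure ν] (T : ℕ)
    (p : Fin T → Kernel (C × E) E) [∀ s, IsMarkovKernel (p s)] :
    IsMarkovKernel (backwardPath ν T p) := by
  induction T with
  | zero => exact Kernel.IsMarkovKernel.map _ (by fun_prop)
  | succ T ih =>
    have := ih (fun s => p s.succ)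
    exact Kernel.IsMarkovKernel.map _ (measurable_cons T)

instance isMarkovKernel_predictor (ν : Measure E) [IsProbabilityMeasure ν] (T : ℕ)
    (p : Fin T → Kernel (C × E) E) [∀ s, IsMarkovKernel (p s)] :
    IsMarkovKernel (predictor ν T p) :=
  Kernel.IsMarkovKernel.map _ (by fun_prop)

end Paths

/-- A probabilistic prediction problem on `C × ℝᴰ` together with a forward noising chain of
horizon `T` and a reference law `ν`. -/
structure DiffusionProblem (C : Type*) [MeasurableSpace C] (D T : ℕ) where
  /-- the joint law of context and target -/
  joint : Measure (C × Vec D)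
  isProb_joint : IsProbabilityMeasure joint
  /-- the true conditional `π⋆` -/
  target : Kernel C (Vec D)
  isMarkov_target : IsMarkovKernel target
  disintegration : joint = joint.fst.compProd target
  /-- the Lebesgue density `π⋆(x ∣ c)`, written `targetDensity c x` -/
  targetDensity : C → Vec D → ℝ≥0
  measurable_targetDensity : Measurable (Function.uncurry targetDensity)
  target_eq : ∀ᵐ c ∂joint.fst, target c = volume.withDensity (fun x => (targetDensity c x : ℝ≥0∞))
  /-- the forward kernels `q_s`, `s = 0, …, T-1` -/
  fwd : Fin T → Kernel (Vec D) (Vec D)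
  isMarkov_fwd : ∀ s, IsMarkovKernel (fwd s)
  /-- the Lebesgue density `q_s(x' ∣ x)`, written `fwdDensity s x x'` -/
  fwdDensity : Fin T → Vec D → Vec D → ℝ≥0
  measurable_fwdDensity : ∀ s, Measurable (Function.uncurry (fwdDensity s))
  fwd_eq : ∀ s x, fwd s x = volume.withDensity (fun x' => (fwdDensity s x x' : ℝ≥0∞))
  fwdDensity_pos : ∀ s x x', 0 < fwdDensity s x x'
  /-- the initialization of the reverse chain -/
  ref : Measure (Vec D)
  isProb_ref : IsProbabilityMeasure ref

attribute [instance] DiffusionProblem.isProb_joint DiffusionProblem.isMarkov_target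
  DiffusionProblem.isMarkov_fwd DiffusionProblem.isProb_ref

namespace DiffusionProblem

variable {C : Type*} [MeasurableSpace C] {D T : ℕ} (S : DiffusionProblem C D T)

/-- The law `P_C` of the context. -/
noncomputable def ctxLaw : Measure C := S.joint.fst

instance : IsProbabilityMeasure S.ctxLaw := by unfold ctxLaw; infer_instance

/-- The kernel `c ↦ q^{π⋆}(dx_{0:T} ∣ c)`. -/
noncomputable def fwdPath : Kernel C (Fin (T + 1) → Vec D) :=
  forwardPath S.target T S.fwd

instance : IsMarkovKernel S.fwdPath := by unfold fwdPath; infer_instance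

/-- The marginal `q_s^{π⋆}(· ∣ c)` of `X_s`, `s = 0, …, T`. -/
noncomputable def fwdMarginal (s : Fin (T + 1)) : Kernel C (Vec D) :=
  S.fwdPath.map (fun x => x s)

/-- The density of `q_s^{π⋆}(· ∣ c)`: `π⋆(u ∣ c)` for `s = 0`, and
`∫ q_{s-1}(u ∣ v) q_{s-1}^{π⋆}(dv ∣ c)` for `s ≥ 1`. -/
noncomputable def marginalDensity (s : Fin (T + 1)) (c : C) (u : Vec D) : ℝ≥0∞ :=
  Fin.cases (motive := fun _ => ℝ≥0∞) (S.targetDensity c u : ℝ≥0∞)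
    (fun k : Fin T => ∫⁻ v, (S.fwdDensity k v u : ℝ≥0∞) ∂(S.fwdMarginal k.castSucc c)) s

/-- The joint law `Q(dc, dx_{0:T}) = P_C(dc) q^{π⋆}(dx_{0:T} ∣ c)`. -/
noncomputable def pathJoint : Measure (C × (Fin (T + 1) → Vec D)) :=
  S.ctxLaw.compProd S.fwdPath

instance : IsProbabilityMeasure S.pathJoint := by unfold pathJoint; infer_instance

/-- The law `Q_t` of `(C, X_{t-1}, X_t)` with `t = s + 1`.  Throughout, an index `s : Fin T`
labels the step between the times `s = t - 1` and `s + 1 = t`. -/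
noncomputable def stepJoint (s : Fin T) : Measure (C × Vec D × Vec D) :=
  S.pathJoint.map (fun p => (p.1, p.2 s.castSucc, p.2 s.succ))

instance (s : Fin T) : IsProbabilityMeasure (S.stepJoint s) :=
  Measure.isProbabilityMeasure_map (by fun_prop)

/-- The law `(Q_t)_{C,X_t}` of `(C, X_t)`, `t = s + 1`. -/
noncomputable def stepInput (s : Fin T) : Measure (C × Vec D) :=
  (S.stepJoint s).map (fun p => (p.1, p.2.2))

/-- The true reverse kernel `r_t⋆(dx_{t-1} ∣ c, x_t)`, `t = s + 1`: the disintegration of `Q_t`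
over `(Q_t)_{C,X_t}`. -/
noncomputable def trueReverse (s : Fin T) : Kernel (C × Vec D) (Vec D) :=
  have : IsProbabilityMeasure
      ((S.stepJoint s).map (fun p => (((p.1, p.2.2), p.2.1) : (C × Vec D) × Vec D))) :=
    Measure.isProbabilityMeasure_map (by fun_prop)
  ((S.stepJoint s).map (fun p => (((p.1, p.2.2), p.2.1) : (C × Vec D) × Vec D))).condKernel

/-- The output error `E_C [KL(π⋆(· ∣ C) ‖ π(· ∣ C))]`. -/
noncomputable def outputKL (π : Kernel C (Vec D)) : ℝ≥0∞ :=
  ∫⁻ c, InformationTheory.klDiv (S.target c) (π c) ∂S.ctxLaw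

/-- Exact terminal matching: `q_T^{π⋆}(· ∣ c) = ν` for almost every context `c`. -/
def ExactTerminalMatching : Prop :=
  ∀ᵐ c ∂S.ctxLaw, S.fwdMarginal (Fin.last T) c = S.ref

end DiffusionProblem

/-- Feature data for all the steps: the feature maps `φ_t : C × ℝᴰ → ℝ^{d_t}`, the sets `K_t` and
the functions `ρ_t⋆(y ∣ z)`, written `rho s z y` with `t = s + 1`.  Only the values of `rho` at
`z ∈ K_t` matter. -/
structure FeatureData (C : Type*) [MeasurableSpace C] (D T : ℕ) where
  dim : Fin T → ℕ
  phi : (s : Fin T) → C × Vec D → Vec (dim s)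
  measurable_phi : ∀ s, Measurable (phi s)
  supp : (s : Fin T) → Set (Vec (dim s))
  rho : (s : Fin T) → Vec (dim s) → Vec D → ℝ≥0
  measurable_rho : ∀ s, Measurable (Function.uncurry (rho s))

section Assumptions

variable {C : Type*} [MeasurableSpace C] {D T : ℕ}

/-- The law `F_t` of `(X_{t-1}, Z_t)`, where `Z_t = φ_t(C, X_t)`, `t = s + 1`. -/
noncomputable def featureJoint (S : DiffusionProblem C D T) (F : FeatureData C D T)
    (s : Fin T) : Measure (Vec D × Vec (F.dim s)) :=
  (S.stepJoint s).map (fun p => (p.2.1, F.phi s (p.1, p.2.2)))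

/-- The law `(F_t)_{Z_t}` of `Z_t`. -/
noncomputable def featureLaw (S : DiffusionProblem C D T) (F : FeatureData C D T)
    (s : Fin T) : Measure (Vec (F.dim s)) :=
  (featureJoint S F s).snd

/-- Properties of the feature maps: compact feature support, disintegration, feature
sufficiency. -/
structure FeatureAssumption (S : DiffusionProblem C D T) (F : FeatureData C D T) : Prop where
  isCompact_supp : ∀ s, IsCompact (F.supp s)
  featureLaw_supp : ∀ s, featureLaw S F s (F.supp s) = 1
  disintegration : ∀ s, featureJoint S F s =
    ((volume : Measure (Vec D)).prod (featureLaw S F s)).withDensity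
      (fun p => (F.rho s p.2 p.1 : ℝ≥0∞))
  sufficiency : ∀ s, ∀ᵐ x ∂(S.stepInput s),
    S.trueReverse s x = volume.withDensity (fun y => (F.rho s (F.phi s x) y : ℝ≥0∞))

/-- Regularity of the forward densities, with cubes of side length `r s` at time `s`.  In the
log-variation bounds the quotient is formed in `[0, ∞]` and the logarithm takes values in
`[-∞, ∞]`, so that the bound forces the infimum over the cube to be positive. -/
structure RegularityAssumption (S : DiffusionProblem C D T) (r : Fin T → ℝ) : Prop where
  target_pos : ∀ᵐ c ∂S.ctxLaw, ∀ x, 0 < S.targetDensity c x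
  fwd_pos : ∀ s x x', 0 < S.fwdDensity s x x'
  target_cont : ∀ᵐ c ∂S.ctxLaw, Continuous (S.targetDensity c)
  fwd_cont : ∀ s v, Continuous (S.fwdDensity s v)
  dominated : ∀ s : Fin T, ∀ᵐ c ∂S.ctxLaw, ∀ K : Set (Vec D), IsCompact K →
    ∃ g : Vec D → ℝ, Integrable g (S.fwdMarginal s.castSucc c) ∧
      ∀ v, ∀ u ∈ K, (S.fwdDensity s v u : ℝ) ≤ g v
  secondMoment : ∀ s : Fin T,
    ∫⁻ c, ∫⁻ y, ‖y‖ₑ ^ 2 ∂(S.fwdMarginal s.castSucc c) ∂S.ctxLaw < ∞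
  side_pos : ∀ s, 0 < r s
  logVariation : ∀ s : Fin T, ∃ (ctr : Vec D → Vec D) (a : Vec D → ℝ≥0)
      (b : Vec D → Vec D → ℝ≥0),
    (∀ x, x ∈ closedCube (ctr x) (r s)) ∧
    Measurable a ∧ Measurable (Function.uncurry b) ∧
    (∀ᵐ c ∂S.ctxLaw, ∀ᵐ x ∂(volume : Measure (Vec D)),
      ENNReal.log (S.marginalDensity s.castSucc c x /
        ⨅ y ∈ closedCube (ctr x) (r s), S.marginalDensity s.castSucc c y)
        ≤ ((a x : ℝ) : EReal)) ∧
    (∀ᵐ p ∂((volume : Measure (Vec D)).prod (volume : Measure (Vec D))),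
      ENNReal.log ((S.fwdDensity s p.1 p.2 : ℝ≥0∞) /
        ⨅ y ∈ closedCube (ctr p.1) (r s), (S.fwdDensity s y p.2 : ℝ≥0∞))
        ≤ ((b p.1 p.2 : ℝ) : EReal)) ∧
    ∫⁻ p, ((a p.2.1 : ℝ≥0∞) + (b p.2.1 p.2.2 : ℝ≥0∞)) ∂(S.stepJoint s) < ∞

end Assumptions

/-- Partition data at one step: for each `m ≥ 1` disjoint hypercubes `A_1, …, A_m` of side length
`h m` with centres `center m j` (which of their faces they contain is left open), the remainder
cell `A_0`, the scales `δ m`, `σ m`, `σ0`, and their required asymptotics; `r` is the side length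
of the cubes in the regularity assumption at the time of the response variable. -/
structure PartitionData (D : ℕ) (r : ℝ) where
  h : ℕ → ℝ
  δ : ℕ → ℝ
  σ : ℕ → ℝ
  σ0 : ℝ
  center : (m : ℕ) → Fin m → Vec D
  cell : (m : ℕ) → Fin m → Set (Vec D)
  h_pos : ∀ m, 1 ≤ m → 0 < h m
  δ_pos : ∀ m, 1 ≤ m → 0 < δ m
  σ_pos : ∀ m, 1 ≤ m → 0 < σ m
  σ0_pos : 0 < σ0
  measurableSet_cell : ∀ m j, MeasurableSet (cell m j)
  openCube_subset : ∀ m j, openCube (center m j) (h m) ⊆ cell m j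
  subset_closedCube : ∀ m j, cell m j ⊆ closedCube (center m j) (h m)
  disjoint_cell : ∀ m, Pairwise (fun i j => Disjoint (cell m i) (cell m j))
  h_tendsto : Tendsto h atTop (𝓝 0)
  δ_tendsto : Tendsto δ atTop (𝓝 0)
  eventually_covers : ∀ y, ∀ᶠ m in atTop, Disjoint (closedCube y (δ m)) (⋃ j, cell m j)ᶜ
  ratio_tendsto : Tendsto (fun m => σ m / δ m) atTop (𝓝 0)
  volume_ratio_tendsto : Tendsto (fun m => δ m ^ (D - 1) * h m / σ m ^ D) atTop (𝓝 0)
  tail_scale : (r / 2) ^ D / (2 * Real.pi * σ0 ^ 2) ^ ((D : ℝ) / 2) ≤ 1 / 2 ^ (D + 1)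

/-- The remainder cell `A_0`. -/
def PartitionData.remainder {D : ℕ} {r : ℝ} (A : PartitionData D r) (m : ℕ) : Set (Vec D) :=
  (⋃ j, A.cell m j)ᶜ

/-- The exact log-odds `Λ_j(z) = log (G_j(z) / G_0(z))`, where `G_j(z) = ∫_{A_j} ρ(y ∣ z) dy` are
the cell probabilities. -/
noncomputable def logOdds {d D : ℕ} {r : ℝ} (rho : Vec d → Vec D → ℝ≥0)
    (A : PartitionData D r) (m : ℕ) (j : Fin m) (z : Vec d) : ℝ :=
  Real.log ((∫ y in A.cell m j, (rho z y : ℝ)) / ∫ y in A.remainder m, (rho z y : ℝ))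

/-- Smooth log-odds: at each step there is a closed cube containing `K_t` such that all the
log-odds extend from `K_t` to functions of class `C^{k_t}` on a neighbourhood of that cube.  (The
`C^{k_t}`-norms of the extensions over the cube are then finite, by compactness.) -/
def SmoothLogOdds {C : Type*} [MeasurableSpace C] {D T : ℕ} (F : FeatureData C D T)
    {r : Fin T → ℝ} (A : (s : Fin T) → PartitionData D (r s)) (k : Fin T → ℕ) : Prop :=
  ∀ s, ∃ (ctr : Vec (F.dim s)) (l : ℝ), 0 < l ∧ F.supp s ⊆ closedCube ctr l ∧
    ∀ m, 1 ≤ m → ∀ j : Fin m, ∃ (U : Set (Vec (F.dim s))) (g : Vec (F.dim s) → ℝ),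
      IsOpen U ∧ closedCube ctr l ⊆ U ∧ ContDiffOn ℝ (k s) g U ∧
      ∀ z ∈ F.supp s, g z = logOdds (F.rho s) (A s) m j z

/-- Feed-forward ReLU networks `ℝⁿ → ℝᵐ` of arbitrary depth and widths: an affine output layer
preceded by any number of hidden layers. -/
inductive ReLUNet : ℕ → ℕ → Type
  | output {n m : ℕ} (W : Matrix (Fin m) (Fin n) ℝ) (b : Fin m → ℝ) : ReLUNet n m
  | hidden {n l m : ℕ} (W : Matrix (Fin l) (Fin n) ℝ) (b : Fin l → ℝ) (rest : ReLUNet l m) :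
      ReLUNet n m

/-- The function computed by a ReLU network. -/
def ReLUNet.eval : {n m : ℕ} → ReLUNet n m → (Fin n → ℝ) → (Fin m → ℝ)
  | _, _, .output W b, x => W.mulVec x + b
  | _, _, .hidden W b rest, x => rest.eval (fun i => max (W.mulVec x i + b i) 0)

theorem ReLUNet.measurable_eval {n m : ℕ} (a : ReLUNet n m) : Measurable a.eval := by
  induction a with
  | output W b =>
    have hc : Continuous fun x => W.mulVec x + b := by fun_prop
    exact hc.measurable
  | hidden W b rest ih =>
    have hc : Continuous fun x i => max (W.mulVec x i + b i) (0 : ℝ) := by fun_prop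
    exact ih.comp hc.measurable

/-- The density of the Gaussian `N(μ, σ² I)` on `ℝᴰ`. -/
noncomputable def gaussianDensity {D : ℕ} (μ : Vec D) (σ : ℝ) (y : Vec D) : ℝ :=
  (2 * Real.pi * σ ^ 2) ^ (-((D : ℝ) / 2)) * Real.exp (-(‖y - μ‖ ^ 2 / (2 * σ ^ 2)))

/-- The Gaussian-mixture density whose weights are the baseline softmax of the logits `u`:
weight `exp u_j / (1 + ∑ exp u_k)` for the component `N(μ_j, σ_m² I)` and weight
`1 / (1 + ∑ exp u_k)` for `N(0, σ0² I)`. -/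
noncomputable def mixtureDensity {D : ℕ} {r : ℝ} (A : PartitionData D r) (m : ℕ)
    (u : Fin m → ℝ) (y : Vec D) : ℝ :=
  ∑ j, Real.exp (u j) / (1 + ∑ k, Real.exp (u k)) * gaussianDensity (A.center m j) (A.σ m) y
    + 1 / (1 + ∑ k, Real.exp (u k)) * gaussianDensity 0 A.σ0 y

theorem gaussianDensity_nonneg {D : ℕ} (μ : Vec D) (σ : ℝ) (y : Vec D) :
    0 ≤ gaussianDensity μ σ y := by
  unfold gaussianDensity
  positivity

theorem hasIntegral_gaussianDensity {D : ℕ} (μ : Vec D) {σ : ℝ} (hσ : 0 < σ) :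
    Integrable (gaussianDensity μ σ) ∧ ∫ y, gaussianDensity μ σ y = 1 := by
  have hb : (0 : ℝ) < 1 / (2 * σ ^ 2) := by positivity
  have h1 : ∫ y : Vec D, Real.exp (-(1 / (2 * σ ^ 2)) * ‖y‖ ^ 2)
      = (2 * Real.pi * σ ^ 2) ^ ((D : ℝ) / 2) := by
    rw [GaussianFourier.integral_rexp_neg_mul_sq_norm hb]
    rw [finrank_euclideanSpace_fin]
    congr 1
    field_simp
  have h2 : ∫ y, gaussianDensity μ σ y = 1 := by
    have : gaussianDensity μ σ = fun y => (2 * Real.pi * σ ^ 2) ^ (-((D : ℝ) / 2)) *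
        (fun w : Vec D => Real.exp (-(1 / (2 * σ ^ 2)) * ‖w‖ ^ 2)) (y - μ) := by
      funext y
      simp only [gaussianDensity]
      congr 2
      field_simp
    rw [this, integral_const_mul,
      integral_sub_right_eq_self (fun w : Vec D => Real.exp (-(1 / (2 * σ ^ 2)) * ‖w‖ ^ 2)) μ,
      h1, ← Real.rpow_add (by positivity)]
    simp
  exact ⟨.of_integral_ne_zero (by rw [h2]; exact one_ne_zero), h2⟩

theorem mixtureDensity_nonneg {D : ℕ} {r : ℝ} (A : PartitionData D r) (m : ℕ)
    (u : Fin m → ℝ) (y : Vec D) : 0 ≤ mixtureDensity A m u y := by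
  have h (μ : Vec D) (σ : ℝ) := gaussianDensity_nonneg μ σ y
  unfold mixtureDensity
  have h0 : (0 : ℝ) ≤ 1 + ∑ k, Real.exp (u k) := by positivity
  exact add_nonneg (Finset.sum_nonneg fun j _ => mul_nonneg (by positivity) (h _ _))
    (mul_nonneg (by positivity) (h _ _))

theorem hasIntegral_mixtureDensity {D : ℕ} {r : ℝ} (A : PartitionData D r) (m : ℕ) (hm : 1 ≤ m)
    (u : Fin m → ℝ) :
    Integrable (mixtureDensity A m u) ∧ ∫ y, mixtureDensity A m u y = 1 := by
  have hj (j : Fin m) := hasIntegral_gaussianDensity (A.center m j) (A.σ_pos m hm)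
  have h0 := hasIntegral_gaussianDensity (0 : Vec D) A.σ0_pos
  have hs : (0 : ℝ) < 1 + ∑ k, Real.exp (u k) := by positivity
  have i1 : Integrable (fun y => ∑ j, Real.exp (u j) / (1 + ∑ k, Real.exp (u k)) *
      gaussianDensity (A.center m j) (A.σ m) y) :=
    integrable_finsetSum _ fun j _ => (hj j).1.const_mul _
  have i2 : Integrable (fun y => 1 / (1 + ∑ k, Real.exp (u k)) * gaussianDensity 0 A.σ0 y) :=
    h0.1.const_mul _
  refine ⟨i1.add i2, ?_⟩
  unfold mixtureDensity
  rw [integral_add i1 i2, integral_finsetSum _ fun j _ => (hj j).1.const_mul _]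
  simp only [integral_const_mul, (hj _).2, h0.2, mul_one]
  rw [← Finset.sum_div, ← add_div, add_comm, div_self hs.ne']

/-- A neural reverse model of horizon `T` with input dimensions `d`: at each step a number of cells
and a ReLU network producing the logits. -/
structure NeuralModel {T : ℕ} (d : Fin T → ℕ) where
  m : Fin T → ℕ
  one_le_m : ∀ s, 1 ≤ m s
  net : (s : Fin T) → ReLUNet (d s) (m s)

section Neural

variable {C : Type*} [MeasurableSpace C] {D T : ℕ}

/-- The reverse kernels `p_t(dy ∣ c, x_t)` of a neural reverse model: the Gaussian mixture with
logits given by the network at `φ_t(c, x_t)`, `t = s + 1`. -/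
noncomputable def neuralKernel (F : FeatureData C D T) {r : Fin T → ℝ}
    (A : (s : Fin T) → PartitionData D (r s)) (N : NeuralModel F.dim) (s : Fin T) :
    Kernel (C × Vec D) (Vec D) :=
  Kernel.withDensity (Kernel.const (C × Vec D) volume)
    (fun x y => ENNReal.ofReal
      (mixtureDensity (A s) (N.m s) ((N.net s).eval (fun i => F.phi s x i)) y))

theorem measurable_neuralDensity (F : FeatureData C D T) {r : Fin T → ℝ}
    (A : (s : Fin T) → PartitionData D (r s)) (N : NeuralModel F.dim) (s : Fin T) :
    Measurable (Function.uncurry fun (x : C × Vec D) y => ENNReal.ofReal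
      (mixtureDensity (A s) (N.m s) ((N.net s).eval (fun i => F.phi s x i)) y)) := by
  have h1 : Measurable fun p : (C × Vec D) × Vec D =>
      (N.net s).eval (fun i => F.phi s p.1 i) := by
    refine (N.net s).measurable_eval.comp ?_
    have := F.measurable_phi s
    fun_prop
  have h2 (j : Fin (N.m s)) : Measurable fun p : (C × Vec D) × Vec D =>
      (N.net s).eval (fun i => F.phi s p.1 i) j := (measurable_pi_apply j).comp h1
  refine ENNReal.measurable_ofReal.comp ?_
  simp only [mixtureDensity, gaussianDensity]
  fun_prop

instance isMarkovKernel_neuralKernel (F : FeatureData C D T) {r : Fin T → ℝ}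
    (A : (s : Fin T) → PartitionData D (r s)) (N : NeuralModel F.dim) (s : Fin T) :
    IsMarkovKernel (neuralKernel F A N s) := by
  refine ⟨fun x => ⟨?_⟩⟩
  have h := hasIntegral_mixtureDensity (A s) (N.m s) (N.one_le_m s)
    ((N.net s).eval (fun i => F.phi s x i))
  rw [neuralKernel, Kernel.withDensity_apply _ (measurable_neuralDensity F A N s),
    withDensity_apply _ MeasurableSet.univ, Measure.restrict_univ, Kernel.const_apply,
    ← ofReal_integral_eq_lintegral_ofReal h.1 (ae_of_all _ fun y => mixtureDensity_nonneg _ _ _ y),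
    h.2, ENNReal.ofReal_one]

/-- The predictor `π_{p,ν}` induced by a neural reverse model `p`. -/
noncomputable def neuralPredictor (S : DiffusionProblem C D T) (F : FeatureData C D T)
    {r : Fin T → ℝ} (A : (s : Fin T) → PartitionData D (r s)) (N : NeuralModel F.dim) :
    Kernel C (Vec D) :=
  predictor S.ref T (neuralKernel F A N)

end Neural

end CondDiffusion

open CondDiffusion

/-!
# Neural reverse chains approximate the target conditional law

By data processing and the chain rule, `klDiv_predictor_le` bounds the divergence of the target
from the predictor by the sum, over the steps, of the divergences between the true reverse kernels
and those of the model, taken in mean under the forward chain.  Exact terminal matching makes the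
initialization contribute nothing, and `lintegral_klDiv_le` passes from joint laws to the mean
divergence given the context.  It remains to approximate a single reverse step.

The reverse density given `(c, x)` is `ρ(· ∣ z)` with `z = φ(c, x)`.  If the mixture weights are the
masses of the cells, then the mixture is in the limit at least `ρ(y ∣ z)` at every Lebesgue point
`y`: the cells are much smaller than the scale of their Gaussians, and these concentrate at `y`
(`PartitionData.ae_eventually_le_mixture`).  To pass to the limit in the divergence, a lower bound
of the mixture is needed that does not depend on the number of cells.  Here it comes from the choice
of the weights: a fraction `ε` of the mass is moved to the broad Gaussian at the origin
(`liftedLogits`).  This costs at most `- log (1 - ε)` and makes the mixture at least a multiple of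
that Gaussian, so that by the second moment assumption only an upper bound for `ρ` is missing.  By
Bayes' formula `ρ` varies by at most the factor `exp (a + b)` over a cube of fixed side length, and
it integrates to one (`FeatureAssumption.rho_le`).  The reverse Fatou lemma then applies
(`exists_net_lintegral_logRatio_le`).

The lifted logits are continuous functions of the log-odds, hence they agree on the feature
support with continuous functions and are approximated there uniformly by ReLU networks
(`exists_reLUNet_approx`, from the lattice form of the Stone-Weierstrass theorem).  A uniform error
of the logits changes the logarithm of the mixture by at most twice that error.

The statement in probability follows by Markov's inequality, and the almost sure convergence along a
subsequence from summability of the mean errors; both use that the divergence is a measurable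
function of the context (`measurable_klDiv_kernel`).
-/

namespace CondDiffusion

/-! ### Kullback-Leibler divergence along the reverse chain -/

section KullbackLeibler

open InformationTheory

variable {X Y : Type*} [MeasurableSpace X] [MeasurableSpace Y]

/-- For two probability measures with densities `f` and `g` with respect to a common measure, the
divergence is at most the integral of the positive part of `log (f / g)`: the negative part of the
log-likelihood ratio only lowers it. -/
theorem klDiv_withDensity_le {m : Measure X} {f g : X → ℝ}
    (hf : Measurable f) (hg : Measurable g) (hf0 : ∀ᵐ x ∂m, 0 ≤ f x) (hg0 : ∀ᵐ x ∂m, 0 < g x)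
    [IsProbabilityMeasure (m.withDensity fun x => ENNReal.ofReal (f x))]
    [IsProbabilityMeasure (m.withDensity fun x => ENNReal.ofReal (g x))] :
    klDiv (m.withDensity fun x => ENNReal.ofReal (f x))
        (m.withDensity fun x => ENNReal.ofReal (g x)) ≤
      ∫⁻ x, ENNReal.ofReal (Real.log (f x / g x)) ∂(m.withDensity fun x => ENNReal.ofReal (f x)) := by
  set μ := m.withDensity fun x => ENNReal.ofReal (f x) with hμ
  set ν := m.withDensity fun x => ENNReal.ofReal (g x) with hν
  set h : X → ℝ≥0∞ := fun x => ENNReal.ofReal (f x / g x) with hh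
  have hhm : Measurable h := (hf.div hg).ennreal_ofReal
  have hνm : ν ≪ m := withDensity_absolutelyContinuous _ _
  have hμν : μ = ν.withDensity h := by
    rw [hν, ← withDensity_mul _ hg.ennreal_ofReal hhm, hμ]
    refine withDensity_congr_ae ?_
    filter_upwards [hf0, hg0] with x h0 h1
    simp only [Pi.mul_apply, hh]
    rw [← ENNReal.ofReal_mul h1.le, mul_div_cancel₀ _ h1.ne']
  have hac : μ ≪ ν := by rw [hμν]; exact withDensity_absolutelyContinuous _ _
  have hder : μ.rnDeriv ν =ᵐ[ν] h := by rw [hμν]; exact Measure.rnDeriv_withDensity _ hhm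
  have h1 : ∫⁻ x, h x ∂ν = 1 := by
    rw [← setLIntegral_univ, ← withDensity_apply _ MeasurableSet.univ, ← hμν, measure_univ]
  have key : klDiv μ ν + 1 ≤ ∫⁻ x, ENNReal.ofReal (Real.log (f x / g x)) ∂μ + 1 := by
    calc klDiv μ ν + 1 = ∫⁻ x, (ENNReal.ofReal (klFun (μ.rnDeriv ν x).toReal) + h x) ∂ν := by
          rw [klDiv_eq_lintegral_klFun_of_ac hac, lintegral_add_right _ hhm, h1]
      _ ≤ ∫⁻ x, (h x * ENNReal.ofReal (Real.log (f x / g x)) + 1) ∂ν := by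
          refine lintegral_mono_ae ?_
          filter_upwards [hder, hνm.ae_le hf0, hνm.ae_le hg0] with x hx h0 h2
          have h3 : 0 ≤ f x / g x := div_nonneg h0 h2.le
          rw [hx]
          simp only [hh, ENNReal.toReal_ofReal h3]
          rw [← ENNReal.ofReal_mul h3, ← ENNReal.ofReal_add (klFun_nonneg h3) h3, klFun]
          have h4 : f x / g x * Real.log (f x / g x) + 1 - f x / g x + f x / g x =
              f x / g x * Real.log (f x / g x) + 1 := by ring
          rw [h4]
          exact ENNReal.ofReal_add_le.trans_eq (by rw [ENNReal.ofReal_one])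
      _ = ∫⁻ x, ENNReal.ofReal (Real.log (f x / g x)) ∂μ + 1 := by
          have hm2 : Measurable fun x => ENNReal.ofReal (Real.log (f x / g x)) :=
            ((hf.div hg).log).ennreal_ofReal
          rw [lintegral_add_right _ measurable_const, lintegral_one, measure_univ]
          conv_rhs => rw [hμν]
          rw [lintegral_withDensity_eq_lintegral_mul _ hhm hm2]
          rfl
  exact (ENNReal.add_le_add_iff_right ENNReal.one_ne_top).1 key

variable [MeasurableSpace.CountablyGenerated Y]

/-- The divergence between two Markov kernels is a measurable function of the parameter. -/
theorem measurable_klDiv_kernel (κ η : Kernel X Y) [IsMarkovKernel κ] [IsMarkovKernel η] :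
    Measurable fun x => klDiv (κ x) (η x) := by
  classical
  have h : (fun x => klDiv (κ x) (η x)) = fun x => if κ x ≪ η x then
      ∫⁻ y, ENNReal.ofReal (klFun (κ.rnDeriv η x y).toReal) ∂(η x) else ∞ := by
    funext x
    rw [klDiv_eq_lintegral_klFun]
    split_ifs with hx
    · refine lintegral_congr_ae ?_
      filter_upwards [Kernel.rnDeriv_eq_rnDeriv_measure (κ := κ) (η := η) (a := x)] with y hy
      rw [hy]
    · rfl
  rw [h]
  refine Measurable.ite (Kernel.measurableSet_absolutelyContinuous κ η) ?_ measurable_const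
  refine Measurable.lintegral_kernel_prod_right ?_
  have := Kernel.measurable_rnDeriv κ η
  have hk : Measurable klFun := by fun_prop
  exact (hk.comp this.ennreal_toReal).ennreal_ofReal

/-- The mean divergence of two kernels is at most the divergence of the joint laws. -/
theorem lintegral_klDiv_le (μ : Measure X) [IsProbabilityMeasure μ] (κ η : Kernel X Y)
    [IsMarkovKernel κ] [IsMarkovKernel η] :
    ∫⁻ x, klDiv (κ x) (η x) ∂μ ≤ klDiv (μ ⊗ₘ κ) (μ ⊗ₘ η) := by
  by_cases hac : μ ⊗ₘ κ ≪ μ ⊗ₘ η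
  swap
  · simp [klDiv_of_not_ac hac]
  have hac' : ∀ᵐ x ∂μ, κ x ≪ η x := hac.kernel_of_compProd
  have hm := Kernel.measurable_rnDeriv κ η
  have heq : μ ⊗ₘ κ = (μ ⊗ₘ η).withDensity (fun p => κ.rnDeriv η p.1 p.2) := by
    ext s hs
    rw [Measure.compProd_apply hs, withDensity_apply _ hs, ← lintegral_indicator hs,
      Measure.lintegral_compProd (hm.indicator hs)]
    refine lintegral_congr_ae ?_
    filter_upwards [hac'] with x hx
    have hsx : MeasurableSet (Prod.mk x ⁻¹' s) := measurable_prodMk_left hs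
    conv_lhs => rw [← Kernel.withDensity_rnDeriv_eq hx]
    rw [Kernel.withDensity_apply' _ hm, ← lintegral_indicator hsx]
    rfl
  have hder : (μ ⊗ₘ κ).rnDeriv (μ ⊗ₘ η) =ᵐ[μ ⊗ₘ η] fun p => κ.rnDeriv η p.1 p.2 := by
    conv_lhs => rw [heq]
    exact Measure.rnDeriv_withDensity _ hm
  have hk : Measurable fun p : X × Y => ENNReal.ofReal (klFun (κ.rnDeriv η p.1 p.2).toReal) := by
    have hk : Measurable klFun := by fun_prop
    exact (hk.comp hm.ennreal_toReal).ennreal_ofReal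
  rw [klDiv_eq_lintegral_klFun_of_ac hac]
  have : ∫⁻ p, ENNReal.ofReal (klFun ((μ ⊗ₘ κ).rnDeriv (μ ⊗ₘ η) p).toReal) ∂(μ ⊗ₘ η) =
      ∫⁻ p, ENNReal.ofReal (klFun (κ.rnDeriv η p.1 p.2).toReal) ∂(μ ⊗ₘ η) :=
    lintegral_congr_ae (by filter_upwards [hder] with p hp; rw [hp])
  rw [this, Measure.lintegral_compProd hk]
  refine (lintegral_congr_ae ?_).le
  filter_upwards [hac'] with x hx
  rw [klDiv_eq_lintegral_klFun_of_ac hx]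
  refine lintegral_congr_ae ?_
  filter_upwards [Kernel.rnDeriv_eq_rnDeriv_measure (κ := κ) (η := η) (a := x)] with y hy
  rw [hy]

variable {C E : Type*} [MeasurableSpace C] [MeasurableSpace E]

theorem predictor_succ_apply (ν : Measure E) [IsProbabilityMeasure ν] {T : ℕ}
    (p : Fin (T + 1) → Kernel (C × E) E) [∀ s, IsMarkovKernel (p s)] (c : C) {t : Set E}
    (ht : MeasurableSet t) :
    predictor ν (T + 1) p c t = ∫⁻ w, p 0 (c, w) t ∂(predictor ν T (fun s => p s.succ) c) := by
  have h0 : Measurable fun x : Fin (T + 2) → E => x 0 := by fun_prop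
  have h0' : Measurable fun x : Fin (T + 1) → E => x 0 := by fun_prop
  have hm : Measurable fun w : E => p 0 (c, w) t :=
    (Kernel.measurable_coe (p 0) ht).comp measurable_prodMk_left
  rw [predictor, Kernel.map_apply' _ h0 _ ht, backwardPath,
    Kernel.map_apply' _ (measurable_cons T) _ (h0 ht),
    Kernel.compProd_apply (measurable_cons T (h0 ht)), predictor, Kernel.map_apply _ h0',
    lintegral_map hm h0']
  simp only [Kernel.comap_apply, Set.preimage_preimage, Fin.cons_zero, Set.preimage_id']

theorem compProd_predictor_succ (P : Measure C) [IsProbabilityMeasure P] (ν : Measure E)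
    [IsProbabilityMeasure ν] {T : ℕ} (p : Fin (T + 1) → Kernel (C × E) E)
    [∀ s, IsMarkovKernel (p s)] :
    P ⊗ₘ predictor ν (T + 1) p =
      ((P ⊗ₘ predictor ν T (fun s => p s.succ)) ⊗ₘ p 0).map (fun z => (z.1.1, z.2)) := by
  have hm : Measurable fun z : (C × E) × E => (z.1.1, z.2) := by fun_prop
  ext s hs
  rw [Measure.map_apply hm hs, Measure.compProd_apply (hm hs), Measure.compProd_apply hs,
    Measure.lintegral_compProd (Kernel.measurable_kernel_prodMk_left (hm hs))]
  refine lintegral_congr fun c => ?_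
  rw [predictor_succ_apply ν p c (measurable_prodMk_left hs)]
  rfl

/-- Error decomposition along the reverse chain.  If the laws `κ s` of a process with terminal law
`ν` are generated backwards in time by the kernels `R s`, then the divergence of its initial law
from the predictor that runs the kernels `p s` instead, also from `ν`, is at most the sum of the
one-step divergences under the law of the process.  Each step is the data processing inequality
followed by the chain rule. -/
theorem klDiv_predictor_le (P : Measure C) [IsProbabilityMeasure P] (ν : Measure E)
    [IsProbabilityMeasure ν] : ∀ (T : ℕ) (κ : Fin (T + 1) → Kernel C E)
    [∀ s, IsMarkovKernel (κ s)] (R p : Fin T → Kernel (C × E) E) [∀ s, IsMarkovKernel (R s)]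
    [∀ s, IsMarkovKernel (p s)]
    (_ : ∀ s : Fin T, P ⊗ₘ κ s.castSucc =
      ((P ⊗ₘ κ s.succ) ⊗ₘ R s).map (fun z => (z.1.1, z.2)))
    (_ : P ⊗ₘ κ (Fin.last T) = P ⊗ₘ Kernel.const C ν),
    klDiv (P ⊗ₘ κ 0) (P ⊗ₘ predictor ν T p) ≤
      ∑ s, klDiv ((P ⊗ₘ κ s.succ) ⊗ₘ R s) ((P ⊗ₘ κ s.succ) ⊗ₘ p s) := by
  intro T
  induction T with
  | zero =>
    intro κ _ R p _ _ _ hlast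
    have h : predictor ν 0 p = Kernel.const C ν := by
      rw [predictor, backwardPath, ← Kernel.map_comp_right _ (by fun_prop) (by fun_prop)]
      exact Kernel.map_id' _
    have hlast' : P ⊗ₘ κ 0 = P ⊗ₘ Kernel.const C ν := hlast
    rw [h, hlast', klDiv_self]
    exact zero_le
  | succ T ih =>
    intro κ _ R p _ _ hR hlast
    have hm : Measurable fun z : (C × E) × E => (z.1.1, z.2) := by fun_prop
    have h0 : P ⊗ₘ κ 0 = ((P ⊗ₘ κ (Fin.succ 0)) ⊗ₘ R 0).map (fun z => (z.1.1, z.2)) := hR 0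
    have ih' := ih (fun s => κ s.succ) (fun s => R s.succ) (fun s => p s.succ)
      (fun s => hR s.succ) hlast
    rw [h0, compProd_predictor_succ, Fin.sum_univ_succ]
    refine (klDiv_map_le _ _ hm).trans ?_
    rw [klDiv_compProd_eq_add, add_comm]
    gcongr

end KullbackLeibler

/-- A sequence of functions whose integrals tend to zero has a subsequence tending to zero almost
everywhere. -/
theorem exists_strictMono_ae_tendsto_zero {X : Type*} [MeasurableSpace X] {μ : Measure X}
    {f : ℕ → X → ℝ≥0∞} (hf : ∀ n, Measurable (f n))
    (h : Tendsto (fun n => ∫⁻ x, f n x ∂μ) atTop (𝓝 0)) :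
    ∃ n : ℕ → ℕ, StrictMono n ∧ ∀ᵐ x ∂μ, Tendsto (fun i => f (n i) x) atTop (𝓝 0) := by
  have hev (i : ℕ) : ∀ᶠ n in atTop, ∫⁻ x, f n x ∂μ ≤ (2⁻¹ : ℝ≥0∞) ^ i :=
    h.eventually (Iic_mem_nhds (ENNReal.pow_pos (by simp) i))
  obtain ⟨n, hn, hle⟩ := extraction_forall_of_eventually' (fun i => eventually_atTop.1 (hev i))
  refine ⟨n, hn, ?_⟩
  have hsum : ∫⁻ x, ∑' i, f (n i) x ∂μ ≠ ∞ := by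
    rw [lintegral_tsum fun i => (hf _).aemeasurable]
    refine ne_top_of_le_ne_top ?_ (ENNReal.tsum_le_tsum hle)
    rw [ENNReal.tsum_geometric]
    simp
  filter_upwards [ae_lt_top' (by fun_prop) hsum] with x hx
  exact ENNReal.tendsto_atTop_zero_of_tsum_ne_top hx.ne

/-! ### Universal approximation by ReLU networks -/

section ReLU

/-- Functions between finite-dimensional coordinate spaces that are obtained from affine maps and
componentwise rectification, one hidden layer being added in front at each step.  The coordinates
are indexed by arbitrary finite types, so that networks can be placed in parallel by means of sum
types. -/
inductive IsReLU : ∀ {ι κ : Type} [Fintype ι] [Fintype κ], ((ι → ℝ) → κ → ℝ) → Prop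
  | affine {ι κ : Type} [Fintype ι] [Fintype κ] (L : (ι → ℝ) →ₗ[ℝ] κ → ℝ) (b : κ → ℝ) :
      IsReLU fun x => L x + b
  | layer {ι l κ : Type} [Fintype ι] [Fintype l] [Fintype κ] (L : (ι → ℝ) →ₗ[ℝ] l → ℝ)
      (b : l → ℝ) {g : (l → ℝ) → κ → ℝ} (hg : IsReLU g) :
      IsReLU fun x => g fun i => max (L x i + b i) 0

namespace IsReLU

variable {ι κ l τ : Type} [Fintype ι] [Fintype κ] [Fintype l] [Fintype τ]

theorem linear (L : (ι → ℝ) →ₗ[ℝ] κ → ℝ) : IsReLU fun x => L x := by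
  simpa using IsReLU.affine L 0

theorem comp_affine {g : (l → ℝ) → κ → ℝ} (hg : IsReLU g) (L : (ι → ℝ) →ₗ[ℝ] l → ℝ)
    (b : l → ℝ) : IsReLU fun x => g (L x + b) := by
  cases hg with
  | affine L' b' =>
    have := IsReLU.affine (L' ∘ₗ L) (L' b + b')
    simpa [add_assoc] using this
  | layer L' b' hg =>
    have := IsReLU.layer (L' ∘ₗ L) (L' b + b') hg
    simpa [add_assoc] using this

theorem comp {f : (ι → ℝ) → l → ℝ} (hf : IsReLU f) :
    ∀ {τ : Type} [Fintype τ] {g : (l → ℝ) → τ → ℝ}, IsReLU g → IsReLU fun x => g (f x) := by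
  induction hf with
  | affine L b => exact fun hg => hg.comp_affine L b
  | layer L b hg ih => exact fun hg' => IsReLU.layer L b (ih hg')

theorem relu : IsReLU fun (x : ι → ℝ) i => max (x i) 0 := by
  simpa using IsReLU.layer (LinearMap.id : (ι → ℝ) →ₗ[ℝ] ι → ℝ) 0 (linear LinearMap.id)

/-- A network can carry further coordinates along unchanged, since `y = max y 0 - max (-y) 0`. -/
theorem sumMap {f : (ι → ℝ) → κ → ℝ} (hf : IsReLU f) (τ : Type) [Fintype τ] :
    IsReLU fun (x : ι ⊕ τ → ℝ) => (Sum.elim (f fun i => x (.inl i)) fun j => x (.inr j)) := by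
  induction hf with
  | @affine ι κ _ _ L b =>
    let L' : (ι ⊕ τ → ℝ) →ₗ[ℝ] κ ⊕ τ → ℝ := LinearMap.pi
      (Sum.elim (fun k => LinearMap.proj k ∘ₗ L ∘ₗ LinearMap.funLeft ℝ ℝ Sum.inl)
        fun j => LinearMap.proj (.inr j))
    convert IsReLU.affine L' (Sum.elim b 0) using 1
    funext x k
    cases k <;> simp [L', LinearMap.funLeft, Function.comp_def]
  | @layer ι l κ _ _ _ L b g hg ih =>
    let L' : (ι ⊕ τ → ℝ) →ₗ[ℝ] l ⊕ (τ ⊕ τ) → ℝ := LinearMap.pi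
      (Sum.elim (fun k => LinearMap.proj k ∘ₗ L ∘ₗ LinearMap.funLeft ℝ ℝ Sum.inl)
        (Sum.elim (fun j => LinearMap.proj (.inr j)) fun j => - LinearMap.proj (.inr j)))
    let M : (l ⊕ (τ ⊕ τ) → ℝ) →ₗ[ℝ] l ⊕ τ → ℝ := LinearMap.pi
      (Sum.elim (fun k => LinearMap.proj (.inl k))
        fun j => LinearMap.proj (.inr (.inl j)) - LinearMap.proj (.inr (.inr j)))
    have h := IsReLU.layer L' (Sum.elim b 0) ((linear M).comp ih)
    convert h using 1
    funext x k
    cases k with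
    | inl k => simp [L', M, LinearMap.funLeft, Function.comp_def]
    | inr j =>
      simp only [L', M, LinearMap.pi_apply, Sum.elim_inr, LinearMap.sub_apply,
        Sum.elim_inl, LinearMap.proj_apply, LinearMap.neg_apply, Pi.zero_apply, add_zero]
      change x (.inr j) = Max.max (x (.inr j)) 0 - Max.max (-x (.inr j)) 0
      rcases le_total 0 (x (.inr j)) with h0 | h0
      · rw [max_eq_left h0, max_eq_right (by linarith)]; ring
      · rw [max_eq_right h0, max_eq_left (by linarith)]; ring

theorem prod {f : (ι → ℝ) → κ → ℝ} {g : (ι → ℝ) → l → ℝ} (hf : IsReLU f) (hg : IsReLU g) :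
    IsReLU fun x => Sum.elim (f x) (g x) := by
  let D : (ι → ℝ) →ₗ[ℝ] ι ⊕ ι → ℝ := LinearMap.funLeft ℝ ℝ (Sum.elim id id)
  let S : (κ ⊕ ι → ℝ) →ₗ[ℝ] ι ⊕ κ → ℝ := LinearMap.funLeft ℝ ℝ Sum.swap
  let S' : (l ⊕ κ → ℝ) →ₗ[ℝ] κ ⊕ l → ℝ := LinearMap.funLeft ℝ ℝ Sum.swap
  have h := ((((linear D).comp (hf.sumMap ι)).comp (linear S)).comp (hg.sumMap κ)).comp (linear S')
  convert h using 1
  funext x k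
  cases k <;> simp [D, S, S', LinearMap.funLeft, Function.comp_def]

/-- Finitely many scalar networks can be combined into one network. -/
theorem pi : ∀ {n : ℕ} {f : Fin n → (ι → ℝ) → ℝ}, (∀ j, IsReLU fun x (_ : Unit) => f j x) →
    IsReLU fun x j => f j x := by
  intro n
  induction n with
  | zero =>
    intro f _
    convert linear (0 : (ι → ℝ) →ₗ[ℝ] Fin 0 → ℝ) using 1
  | succ n ih =>
    intro f hf
    let S : (Unit ⊕ Fin n → ℝ) →ₗ[ℝ] Fin (n + 1) → ℝ :=
      LinearMap.funLeft ℝ ℝ (Fin.cases (Sum.inl ()) Sum.inr)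
    have h := ((hf 0).prod (ih fun j => hf j.succ)).comp (linear S)
    convert h using 1
    funext x j
    refine Fin.cases ?_ (fun j => ?_) j <;> simp [S, LinearMap.funLeft]

theorem max {f g : (ι → ℝ) → ℝ} (hf : IsReLU fun x (_ : Unit) => f x)
    (hg : IsReLU fun x (_ : Unit) => g x) : IsReLU fun x (_ : Unit) => max (f x) (g x) := by
  -- `max (f, g) = max (f - g, 0) + max (g, 0) - max (-g, 0)`
  let L : (Unit ⊕ Unit → ℝ) →ₗ[ℝ] Fin 3 → ℝ := LinearMap.pi
    (![LinearMap.proj (.inl ()) - LinearMap.proj (.inr ()), LinearMap.proj (.inr ()),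
      - LinearMap.proj (.inr ())] : Fin 3 → (Unit ⊕ Unit → ℝ) →ₗ[ℝ] ℝ)
  let π (i : Fin 3) : (Fin 3 → ℝ) →ₗ[ℝ] ℝ := LinearMap.proj i
  let M : (Fin 3 → ℝ) →ₗ[ℝ] Unit → ℝ := LinearMap.pi fun _ => π 0 + π 1 - π 2
  have h := (((hf.prod hg).comp (linear L)).comp relu).comp (linear M)
  convert h using 1
  funext x _
  simp only [L, M, π, LinearMap.pi_apply, LinearMap.sub_apply, LinearMap.add_apply,
    LinearMap.proj_apply, LinearMap.neg_apply, Matrix.cons_val, Sum.elim_inl, Sum.elim_inr]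
  rcases le_total (f x) (g x) with h0 | h0 <;> rcases le_total 0 (g x) with h1 | h1
  · rw [max_eq_right h0, max_eq_right (by linarith), max_eq_left h1, max_eq_right (by linarith)]
    ring
  · rw [max_eq_right h0, max_eq_right (by linarith), max_eq_right h1, max_eq_left (by linarith)]
    ring
  · rw [max_eq_left h0, max_eq_left (by linarith), max_eq_left h1, max_eq_right (by linarith)]
    ring
  · rw [max_eq_left h0, max_eq_left (by linarith), max_eq_right h1, max_eq_left (by linarith)]
    ring

theorem neg {f : (ι → ℝ) → ℝ} (hf : IsReLU fun x (_ : Unit) => f x) :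
    IsReLU fun x (_ : Unit) => - f x := by
  convert hf.comp (linear (- LinearMap.id : (Unit → ℝ) →ₗ[ℝ] Unit → ℝ)) using 1
  funext x _
  simp

theorem min {f g : (ι → ℝ) → ℝ} (hf : IsReLU fun x (_ : Unit) => f x)
    (hg : IsReLU fun x (_ : Unit) => g x) : IsReLU fun x (_ : Unit) => min (f x) (g x) := by
  convert (hf.neg.max hg.neg).neg using 3
  rw [max_neg_neg, neg_neg]

/-- Every function of the class is computed by a network, in any coordinates. -/
theorem exists_net {f : (ι → ℝ) → κ → ℝ} (hf : IsReLU f) :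
    ∀ {n m : ℕ} (e : ι ≃ Fin n) (e' : κ ≃ Fin m),
      ∃ a : ReLUNet n m, ∀ x, a.eval x = fun j => f (fun i => x (e i)) (e'.symm j) := by
  induction hf with
  | @affine ι κ _ _ L b =>
    intro n m e e'
    let L' : (Fin n → ℝ) →ₗ[ℝ] Fin m → ℝ :=
      LinearMap.funLeft ℝ ℝ e'.symm ∘ₗ L ∘ₗ LinearMap.funLeft ℝ ℝ e
    refine ⟨.output (LinearMap.toMatrix' L') fun j => b (e'.symm j), fun x => ?_⟩
    funext j
    simp only [ReLUNet.eval, LinearMap.toMatrix'_mulVec]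
    simp [L', LinearMap.funLeft, Function.comp_def]
  | @layer ι l κ _ _ _ L b g hg ih =>
    intro n m e e'
    obtain ⟨a, ha⟩ := ih (Fintype.equivFin l) e'
    let L' : (Fin n → ℝ) →ₗ[ℝ] Fin (Fintype.card l) → ℝ :=
      LinearMap.funLeft ℝ ℝ (Fintype.equivFin l).symm ∘ₗ L ∘ₗ LinearMap.funLeft ℝ ℝ e
    refine ⟨.hidden (LinearMap.toMatrix' L') (fun j => b ((Fintype.equivFin l).symm j)) a,
      fun x => ?_⟩
    simp only [ReLUNet.eval, ha, LinearMap.toMatrix'_mulVec]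
    simp [L', LinearMap.funLeft, Function.comp_def]

end IsReLU

/-- **Universal approximation** on compact sets.  The restrictions of scalar networks to a compact
set form a lattice of continuous functions that takes arbitrary values at any two points, so the
lattice form of the Stone-Weierstrass theorem applies. -/
theorem exists_isReLU_approx {n : ℕ} {K : Set (Fin n → ℝ)} (hK : IsCompact K)
    {f : (Fin n → ℝ) → ℝ} (hf : ContinuousOn f K) {ε : ℝ} (hε : 0 < ε) :
    ∃ g : (Fin n → ℝ) → ℝ, (IsReLU fun x (_ : Unit) => g x) ∧ ∀ x ∈ K, |g x - f x| < ε := by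
  have : CompactSpace K := isCompact_iff_compactSpace.1 hK
  let L : Set C(K, ℝ) := {φ | ∃ g : (Fin n → ℝ) → ℝ, (IsReLU fun x (_ : Unit) => g x) ∧
    ∀ x : K, φ x = g x}
  have haff (A : (Fin n → ℝ) →ₗ[ℝ] ℝ) (b : ℝ) :
      IsReLU fun (x : Fin n → ℝ) (_ : Unit) => A x + b :=
    IsReLU.affine (LinearMap.pi fun _ : Unit => A) fun _ => b
  have hL : closure L = ⊤ := by
    refine ContinuousMap.sublattice_closure_eq_top L ⟨ContinuousMap.const K 0, fun _ => 0, ?_, ?_⟩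
      ?_ ?_ ?_
    · simpa using haff 0 0
    · simp
    · rintro φ ⟨g, hg, hφ⟩ ψ ⟨g', hg', hψ⟩
      exact ⟨_, hg.min hg', fun x => by simp [hφ, hψ]⟩
    · rintro φ ⟨g, hg, hφ⟩ ψ ⟨g', hg', hψ⟩
      exact ⟨_, hg.max hg', fun x => by simp [hφ, hψ]⟩
    · intro v x y
      by_cases hxy : x = y
      · subst hxy
        exact ⟨ContinuousMap.const K (v x), ⟨fun _ => v x, by simpa using haff 0 (v x), by simp⟩,
          by simp, by simp⟩
      · obtain ⟨i, hi⟩ : ∃ i, x.1 i ≠ y.1 i := by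
          by_contra! h
          exact hxy (Subtype.ext (funext h))
        have hi' : y.1 i - x.1 i ≠ 0 := sub_ne_zero.2 hi.symm
        let s := (v y - v x) / (y.1 i - x.1 i)
        let A : (Fin n → ℝ) →ₗ[ℝ] ℝ := s • LinearMap.proj i
        have hAc : Continuous fun z : K => A z + (v x - s * x.1 i) := by
          have hi : Continuous fun z : K => z.1 i := (continuous_apply i).comp continuous_subtype_val
          exact (hi.const_smul s).add continuous_const
        refine ⟨⟨_, hAc⟩, ⟨fun z => A z + (v x - s * x.1 i), haff _ _, fun z => rfl⟩, ?_, ?_⟩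
        · simp [A]
        · simp only [A, s, ContinuousMap.coe_mk, LinearMap.smul_apply, LinearMap.proj_apply,
            smul_eq_mul]
          field_simp
          ring
  let F : C(K, ℝ) := ⟨K.domRestrict f, hf.domRestrict⟩
  have hF : F ∈ closure L := by rw [hL]; trivial
  obtain ⟨φ, ⟨g, hg, hφ⟩, hd⟩ := Metric.mem_closure_iff.1 hF ε hε
  refine ⟨g, hg, fun x hx => ?_⟩
  have h1 := (ContinuousMap.dist_apply_le_dist (f := φ) (g := F) ⟨x, hx⟩).trans_lt
    (by rwa [dist_comm])
  rw [Real.dist_eq, hφ] at h1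
  exact h1

/-- Universal approximation for vector-valued functions on Euclidean space. -/
theorem exists_reLUNet_approx {d m : ℕ} {K : Set (Vec d)} (hK : IsCompact K)
    {f : Fin m → Vec d → ℝ} (hf : ∀ j, ContinuousOn (f j) K) {ε : ℝ} (hε : 0 < ε) :
    ∃ a : ReLUNet d m, ∀ z ∈ K, ∀ j, |a.eval (fun i => z i) j - f j z| < ε := by
  let e := EuclideanSpace.equiv (Fin d) ℝ
  have hK' : IsCompact (e '' K) := hK.image e.continuous
  have hf' (j : Fin m) : ContinuousOn (fun x => f j (e.symm x)) (e '' K) := by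
    refine (hf j).comp e.symm.continuous.continuousOn ?_
    rintro _ ⟨z, hz, rfl⟩
    simpa using hz
  choose g hg hgf using fun j => exists_isReLU_approx hK' (hf' j) hε
  obtain ⟨a, ha⟩ := (IsReLU.pi hg).exists_net (Equiv.refl _) (Equiv.refl _)
  refine ⟨a, fun z hz j => ?_⟩
  have := hgf j (e z) ⟨z, hz, rfl⟩
  rw [ha]
  rwa [e.symm_apply_apply] at this

end ReLU

/-! ### Gaussian mixtures at Lebesgue points -/

section Gaussian

variable {D : ℕ}

theorem norm_sub_le_of_mem_closedCube {x y : Vec D} {h : ℝ} (hy : y ∈ closedCube x h) :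
    ‖y - x‖ ≤ D * h := by
  rcases Nat.eq_zero_or_pos D with rfl | hD
  · simp [EuclideanSpace.norm_eq]
  have h0 : 0 ≤ h := by have := (abs_nonneg _).trans (hy ⟨0, hD⟩); linarith
  have hD' : (1 : ℝ) ≤ D := by exact_mod_cast hD
  refine abs_le_of_sq_le_sq' ?_ (by positivity) |>.2
  rw [EuclideanSpace.real_norm_sq_eq]
  calc ∑ i, (y - x) i ^ 2 ≤ ∑ _i : Fin D, (h / 2) ^ 2 := by
        refine Finset.sum_le_sum fun i _ => ?_
        exact sq_le_sq' (abs_le.1 (hy i)).1 (abs_le.1 (hy i)).2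
    _ = D * (h / 2) ^ 2 := by simp
    _ ≤ (D * h) ^ 2 := by
        have h1 : 0 ≤ (D : ℝ) * (D - 1) * h ^ 2 :=
          mul_nonneg (mul_nonneg (by positivity) (sub_nonneg.2 hD')) (sq_nonneg h)
        have h2 : 0 ≤ (D : ℝ) * h ^ 2 := by positivity
        nlinarith

theorem closedBall_subset_closedCube (x : Vec D) {R h : ℝ} (hR : R ≤ h / 2) :
    Metric.closedBall x R ⊆ closedCube x h := fun y hy i => by
  rw [mem_closedBall_iff_norm] at hy
  exact ((PiLp.norm_apply_le (y - x) i).trans hy).trans hR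

theorem continuous_gaussianDensity (μ : Vec D) (σ : ℝ) : Continuous (gaussianDensity μ σ) := by
  unfold gaussianDensity
  fun_prop

theorem gaussianDensity_comm (μ y : Vec D) (σ : ℝ) :
    gaussianDensity μ σ y = gaussianDensity y σ μ := by
  unfold gaussianDensity
  rw [norm_sub_rev]

theorem gaussianDensity_pos (μ : Vec D) {σ : ℝ} (hσ : 0 < σ) (y : Vec D) :
    0 < gaussianDensity μ σ y := by
  unfold gaussianDensity
  positivity

theorem gaussianDensity_const_eq {σ : ℝ} (hσ : 0 < σ) :
    (2 * Real.pi * σ ^ 2) ^ (-((D : ℝ) / 2)) = (2 * Real.pi) ^ (-((D : ℝ) / 2)) / σ ^ D := by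
  rw [Real.mul_rpow (by positivity) (by positivity), Real.rpow_neg (sq_nonneg σ),
    ← Real.rpow_natCast σ 2, ← Real.rpow_mul hσ.le, div_eq_mul_inv]
  congr 2
  rw [← Real.rpow_natCast σ D]
  congr 1
  push_cast
  ring

theorem gaussianDensity_le (μ : Vec D) {σ : ℝ} (hσ : 0 < σ) (y : Vec D) :
    gaussianDensity μ σ y ≤ (2 * Real.pi) ^ (-((D : ℝ) / 2)) / σ ^ D := by
  rw [← gaussianDensity_const_eq hσ, gaussianDensity]
  refine mul_le_of_le_one_right (by positivity) (Real.exp_le_one_iff.2 ?_)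
  have : 0 ≤ ‖y - μ‖ ^ 2 / (2 * σ ^ 2) := by positivity
  linarith

theorem gaussianDensity_eq_scaled (μ : Vec D) {σ : ℝ} (hσ : 0 < σ) (y : Vec D) :
    gaussianDensity μ σ y = (σ ^ D)⁻¹ * gaussianDensity 0 1 (σ⁻¹ • (y - μ)) := by
  unfold gaussianDensity
  rw [gaussianDensity_const_eq hσ, sub_zero, norm_smul, norm_inv, Real.norm_eq_abs,
    abs_of_pos hσ, one_pow, mul_one]
  have : (σ⁻¹ * ‖y - μ‖) ^ 2 / (2 * 1) = ‖y - μ‖ ^ 2 / (2 * σ ^ 2) := by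
    field_simp
  rw [this]
  ring

/-- Moving the centre of a Gaussian by at most `e` costs at most a factor `exp (-κ)` at points
within `R` of the original centre. -/
theorem gaussianDensity_shift {u μ y : Vec D} {σ R e : ℝ}
    (hu : ‖y - u‖ ≤ R) (he : ‖u - μ‖ ≤ e) :
    Real.exp (-((2 * R * e + e ^ 2) / (2 * σ ^ 2))) * gaussianDensity u σ y ≤
      gaussianDensity μ σ y := by
  have h1 : ‖y - μ‖ ≤ ‖y - u‖ + ‖u - μ‖ := norm_sub_le_norm_sub_add_norm_sub _ _ _
  have h2 : ‖y - μ‖ ^ 2 ≤ ‖y - u‖ ^ 2 + (2 * R * e + e ^ 2) := by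
    have a1 := norm_nonneg (y - u)
    have a2 := norm_nonneg (u - μ)
    have a3 := norm_nonneg (y - μ)
    have a4 : ‖y - u‖ * ‖u - μ‖ ≤ R * e := mul_le_mul hu he a2 (a1.trans hu)
    nlinarith
  unfold gaussianDensity
  rw [mul_left_comm, ← Real.exp_add]
  refine mul_le_mul_of_nonneg_left (Real.exp_le_exp.2 ?_) (by positivity)
  rw [← neg_add, neg_le_neg_iff, ← add_div]
  gcongr
  linarith

/-- The mass that the standard Gaussian gives to the ball of radius `R`. -/
noncomputable def gaussianBallMass (D : ℕ) (R : ℝ) : ℝ :=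
  ∫ u in Metric.closedBall (0 : Vec D) R, gaussianDensity 0 1 u

theorem tendsto_gaussianBallMass : Tendsto (gaussianBallMass D) atTop (𝓝 1) := by
  have h := hasIntegral_gaussianDensity (0 : Vec D) one_pos
  rw [← h.2]
  exact (aecover_closedBall tendsto_id).integral_tendsto_of_countably_generated h.1

theorem setIntegral_gaussianDensity (μ : Vec D) {σ : ℝ} (hσ : 0 < σ) (R : ℝ) :
    ∫ u in Metric.closedBall μ (R * σ), gaussianDensity μ σ u = gaussianBallMass D R := by
  let F : Vec D → ℝ := (Metric.closedBall 0 R).indicator (gaussianDensity 0 1)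
  have h1 : (Metric.closedBall μ (R * σ)).indicator (gaussianDensity μ σ) =
      fun u => (σ ^ D)⁻¹ * F (σ⁻¹ • (u - μ)) := by
    funext u
    have hiff : u ∈ Metric.closedBall μ (R * σ) ↔ σ⁻¹ • (u - μ) ∈ Metric.closedBall (0 : Vec D) R := by
      rw [mem_closedBall_iff_norm, mem_closedBall_zero_iff, norm_smul, norm_inv, Real.norm_eq_abs,
        abs_of_pos hσ, inv_mul_le_iff₀ hσ, mul_comm]
    by_cases hu : u ∈ Metric.closedBall μ (R * σ)
    · simp only [F, Set.indicator_of_mem hu, Set.indicator_of_mem (hiff.1 hu)]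
      exact gaussianDensity_eq_scaled μ hσ u
    · simp only [F, Set.indicator_of_notMem hu, Set.indicator_of_notMem (fun h => hu (hiff.2 h)),
        mul_zero]
  rw [← integral_indicator Metric.isClosed_closedBall.measurableSet, h1, integral_const_mul,
    integral_sub_right_eq_self (fun u => F (σ⁻¹ • u)) μ,
    Measure.integral_comp_inv_smul_of_nonneg _ _ hσ.le, finrank_euclideanSpace_fin, smul_eq_mul,
    inv_mul_cancel_left₀ (by positivity), integral_indicator Metric.isClosed_closedBall.measurableSet]
  rfl

/-- A lower bound for a Gaussian average over a ball by the value at the centre and the mean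
oscillation over the ball. -/
theorem gaussian_average_ge {ρ : Vec D → ℝ} (hρ : Integrable ρ)
    (y : Vec D) {σ R : ℝ} (hσ : 0 < σ) (hR : 0 < R) :
    gaussianBallMass D R * ρ y - (2 * Real.pi) ^ (-((D : ℝ) / 2)) * R ^ D *
        (volume : Measure (Vec D)).real (Metric.closedBall 0 1) *
        (⨍ u in Metric.closedBall y (R * σ), ‖ρ u - ρ y‖) ≤
      ∫ u in Metric.closedBall y (R * σ), ρ u * gaussianDensity y σ u := by
  set B := Metric.closedBall y (R * σ) with hB
  have hBm : MeasurableSet B := Metric.isClosed_closedBall.measurableSet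
  have hBf : volume B ≠ ∞ := measure_closedBall_lt_top.ne
  have : IsFiniteMeasure (volume.restrict B) := ⟨by simpa using hBf.lt_top⟩
  set c := (2 * Real.pi) ^ (-((D : ℝ) / 2)) / σ ^ D with hc
  have hg := (hasIntegral_gaussianDensity y hσ).1.integrableOn (s := B)
  have hosc : IntegrableOn (fun u => ‖ρ u - ρ y‖) B :=
    (hρ.integrableOn.sub (integrable_const _)).norm
  have hprod : IntegrableOn (fun u => ρ u * gaussianDensity y σ u) B := by
    refine (hρ.integrableOn (s := B)).mul_bdd (c := c)
      (continuous_gaussianDensity y σ).aestronglyMeasurable (ae_of_all _ fun u => ?_)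
    rw [Real.norm_of_nonneg (gaussianDensity_nonneg _ _ _)]
    exact gaussianDensity_le y hσ u
  have hvol : (volume : Measure (Vec D)).real B =
      (R * σ) ^ D * (volume : Measure (Vec D)).real (Metric.closedBall 0 1) := by
    have := Measure.addHaar_real_closedBall' (volume : Measure (Vec D)) y (r := R * σ) (by positivity)
    rwa [finrank_euclideanSpace_fin] at this
  have hvol0 : (volume : Measure (Vec D)).real B ≠ 0 :=
    (ENNReal.toReal_pos (Metric.measure_closedBall_pos _ _ (by positivity)).ne' hBf).ne'
  have hav : (2 * Real.pi) ^ (-((D : ℝ) / 2)) * R ^ D *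
        (volume : Measure (Vec D)).real (Metric.closedBall 0 1) * (⨍ u in B, ‖ρ u - ρ y‖) =
      ∫ u in B, c * ‖ρ u - ρ y‖ := by
    rw [setAverage_eq, integral_const_mul, smul_eq_mul, hc]
    have e : (2 * Real.pi) ^ (-((D : ℝ) / 2)) * R ^ D *
        (volume : Measure (Vec D)).real (Metric.closedBall 0 1) =
        (2 * Real.pi) ^ (-((D : ℝ) / 2)) / σ ^ D * (volume : Measure (Vec D)).real B := by
      rw [hvol, mul_pow]
      field_simp
    rw [e, mul_assoc, mul_inv_cancel_left₀ hvol0]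
  rw [hav, ← setIntegral_gaussianDensity y hσ R, ← integral_mul_const,
    ← integral_sub (hg.mul_const _) (hosc.const_mul c)]
  refine integral_mono ((hg.mul_const _).sub (hosc.const_mul c)) hprod fun u => ?_
  have h1 := gaussianDensity_nonneg y σ u
  have h2 : gaussianDensity y σ u ≤ c := gaussianDensity_le y hσ u
  have h3 : ρ y - ρ u ≤ ‖ρ u - ρ y‖ := by rw [norm_sub_rev]; exact Real.le_norm_self _
  have h4 : gaussianDensity y σ u * (ρ y - ρ u) ≤ c * ‖ρ u - ρ y‖ :=
    (mul_le_mul_of_nonneg_left h3 h1).trans (mul_le_mul_of_nonneg_right h2 (norm_nonneg _))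
  dsimp only
  nlinarith

end Gaussian

section Partition

variable {D : ℕ} {r : ℝ} (A : PartitionData D r)

theorem PartitionData.σ_tendsto : Tendsto A.σ atTop (𝓝 0) := by
  have h := A.ratio_tendsto.mul A.δ_tendsto
  rw [mul_zero] at h
  refine h.congr' ?_
  filter_upwards [eventually_ge_atTop 1] with m hm
  have := (A.δ_pos m hm).ne'
  field_simp

theorem PartitionData.h_div_σ_tendsto (hD : 1 ≤ D) :
    Tendsto (fun m => A.h m / A.σ m) atTop (𝓝 0) := by
  have h := A.volume_ratio_tendsto.mul (A.ratio_tendsto.pow (D - 1))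
  rw [zero_mul] at h
  refine h.congr' ?_
  filter_upwards [eventually_ge_atTop 1] with m hm
  have h1 := (A.δ_pos m hm).ne'
  have h2 := (A.σ_pos m hm).ne'
  obtain ⟨E, rfl⟩ : ∃ E, D = E + 1 := ⟨D - 1, by omega⟩
  rw [Nat.add_sub_cancel, div_pow]
  field_simp
  ring

/-- As the partition is refined, the Gaussian mixture whose weights are the masses of the cells
recovers at least the density in the limit, at every Lebesgue point. -/
theorem PartitionData.ae_eventually_le_mixture (hD : 1 ≤ D) {ρ : Vec D → ℝ} (hρ : Integrable ρ)
    (hρ0 : ∀ u, 0 ≤ ρ u) : ∀ᵐ y, ∀ γ < 1, ∀ᶠ m in atTop,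
      γ * ρ y ≤ ∑ j, (∫ u in A.cell m j, ρ u) * gaussianDensity (A.center m j) (A.σ m) y := by
  filter_upwards [IsUnifLocDoublingMeasure.ae_tendsto_average_norm_sub (volume : Measure (Vec D))
    hρ.locallyIntegrable 1] with y hy γ hγ
  rcases (hρ0 y).eq_or_lt with h0 | hpos
  · refine Eventually.of_forall fun m => ?_
    rw [← h0, mul_zero]
    exact Finset.sum_nonneg fun j _ => mul_nonneg (integral_nonneg hρ0) (gaussianDensity_nonneg _ _ _)
  obtain ⟨R, hRγ, hR⟩ := ((tendsto_gaussianBallMass (D := D)).eventually (lt_mem_nhds hγ) |>.and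
    (eventually_gt_atTop 0)).exists
  have hRσ : Tendsto (fun m => R * A.σ m) atTop (𝓝[>] 0) := by
    refine tendsto_nhdsWithin_iff.2 ⟨by simpa using A.σ_tendsto.const_mul R, ?_⟩
    filter_upwards [eventually_ge_atTop 1] with m hm
    exact mul_pos hR (A.σ_pos m hm)
  have hosc : Tendsto (fun m => ⨍ u in Metric.closedBall y (R * A.σ m), ‖ρ u - ρ y‖) atTop (𝓝 0) := by
    refine hy (fun _ => y) (fun m => R * A.σ m) hRσ ?_
    filter_upwards [eventually_ge_atTop 1] with m hm
    exact Metric.mem_closedBall_self (by have := A.σ_pos m hm; positivity)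
  -- the exponent lost when the points of a cell are moved to its centre
  have hκ : Tendsto (fun m => (2 * (R * A.σ m) * (D * A.h m) + (D * A.h m) ^ 2) /
      (2 * A.σ m ^ 2)) atTop (𝓝 0) := by
    have hx := A.h_div_σ_tendsto hD
    have h := (hx.const_mul (R * D)).add ((hx.pow 2).const_mul ((D : ℝ) ^ 2 / 2))
    simp only [mul_zero, ne_eq, OfNat.ofNat_ne_zero, not_false_eq_true, zero_pow, add_zero] at h
    refine h.congr' ?_
    filter_upwards [eventually_ge_atTop 1] with m hm
    have := (A.σ_pos m hm).ne'
    field_simp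
  set c := (2 * Real.pi) ^ (-((D : ℝ) / 2)) * R ^ D *
        (volume : Measure (Vec D)).real (Metric.closedBall 0 1) with hc
  have hlim := (Real.continuous_exp.tendsto _ |>.comp hκ.neg).mul
    ((tendsto_const_nhds (x := gaussianBallMass D R * ρ y)).sub (hosc.const_mul c))
  rw [neg_zero, Real.exp_zero, mul_zero, sub_zero, one_mul] at hlim
  filter_upwards [hlim.eventually (lt_mem_nhds (mul_lt_mul_of_pos_right hRγ hpos)),
    eventually_ge_atTop 1, A.eventually_covers y,
    A.ratio_tendsto.eventually (gt_mem_nhds (show (0 : ℝ) < 1 / (2 * R) by positivity))]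
    with m hm hm1 hcov hratio
  have hσ := A.σ_pos m hm1
  have hδ := A.δ_pos m hm1
  set B := Metric.closedBall y (R * A.σ m) with hB
  have hBU : B ⊆ ⋃ j, A.cell m j := by
    refine (closedBall_subset_closedCube y ?_).trans (Set.disjoint_compl_right_iff_subset.1 hcov)
    rw [div_lt_div_iff₀ hδ (by positivity)] at hratio
    linarith
  set κ := (2 * (R * A.σ m) * (D * A.h m) + (D * A.h m) ^ 2) / (2 * A.σ m ^ 2)
  have hBm : MeasurableSet B := Metric.isClosed_closedBall.measurableSet
  have hint : IntegrableOn (fun u => ρ u * gaussianDensity y (A.σ m) u) B := by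
    refine (hρ.integrableOn (s := B)).mul_bdd (c := (2 * Real.pi) ^ (-((D : ℝ) / 2)) / A.σ m ^ D)
      (continuous_gaussianDensity y _).aestronglyMeasurable (ae_of_all _ fun u => ?_)
    rw [Real.norm_of_nonneg (gaussianDensity_nonneg _ _ _)]
    exact gaussianDensity_le y hσ u
  calc γ * ρ y ≤ Real.exp (-κ) * (gaussianBallMass D R * ρ y - c * ⨍ u in B, ‖ρ u - ρ y‖) := hm.le
    _ ≤ Real.exp (-κ) * ∫ u in B, ρ u * gaussianDensity y (A.σ m) u :=
        mul_le_mul_of_nonneg_left (gaussian_average_ge hρ y hσ hR) (Real.exp_nonneg _)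
    _ = Real.exp (-κ) * ∑ j, ∫ u in A.cell m j ∩ B, ρ u * gaussianDensity y (A.σ m) u := by
        rw [← integral_iUnion_fintype (fun j => (A.measurableSet_cell m j).inter hBm)
          (fun i j hij => (A.disjoint_cell m hij).mono Set.inter_subset_left Set.inter_subset_left)
          (fun j => hint.mono_set Set.inter_subset_right), ← Set.iUnion_inter,
          Set.inter_eq_right.2 hBU]
    _ ≤ ∑ j, (∫ u in A.cell m j, ρ u) * gaussianDensity (A.center m j) (A.σ m) y := by
        rw [Finset.mul_sum]
        refine Finset.sum_le_sum fun j _ => ?_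
        rw [← integral_const_mul, ← integral_mul_const]
        refine (setIntegral_mono_on ((hint.mono_set Set.inter_subset_right).const_mul _)
          (hρ.integrableOn.mul_const _) ((A.measurableSet_cell m j).inter hBm)
          fun u hu => ?_).trans (setIntegral_mono_set (hρ.integrableOn.mul_const _)
            (ae_of_all _ fun u => mul_nonneg (hρ0 u) (gaussianDensity_nonneg _ _ _))
            Set.inter_subset_left.eventuallyLE)
        have h := gaussianDensity_shift (σ := A.σ m) (u := u) (μ := A.center m j) (y := y)
          (R := R * A.σ m) (e := D * A.h m)
          (by rw [norm_sub_rev]; exact mem_closedBall_iff_norm.1 hu.2)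
          (norm_sub_le_of_mem_closedCube (A.subset_closedCube m j hu.1))
        rw [gaussianDensity_comm y u, mul_left_comm]
        exact mul_le_mul_of_nonneg_left h (hρ0 u)

end Partition

/-! ### Mixture weights and their logits -/

section Mixture

variable {D : ℕ} {r : ℝ} (A : PartitionData D r)

/-- The mixture density is stable under uniform perturbations of the logits. -/
theorem mixtureDensity_perturb {m : ℕ} {u v : Fin m → ℝ} {ε : ℝ} (hε : 0 ≤ ε)
    (h : ∀ j, |u j - v j| ≤ ε) (y : Vec D) :
    Real.exp (-(2 * ε)) * mixtureDensity A m v y ≤ mixtureDensity A m u y := by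
  have hu : 0 < 1 + ∑ k, Real.exp (u k) := by positivity
  have hv : 0 < 1 + ∑ k, Real.exp (v k) := by positivity
  have h1 : 1 + ∑ k, Real.exp (u k) ≤ Real.exp ε * (1 + ∑ k, Real.exp (v k)) := by
    rw [mul_add, mul_one, Finset.mul_sum]
    refine add_le_add (Real.one_le_exp hε) (Finset.sum_le_sum fun k _ => ?_)
    rw [← Real.exp_add]
    exact Real.exp_le_exp.2 (by linarith [(abs_le.1 (h k)).2])
  -- a weight with numerator `exp a` loses at most a factor `exp (-2 ε)`
  have key {a b : ℝ} (hab : b - ε ≤ a) :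
      Real.exp (-(2 * ε)) * (Real.exp b / (1 + ∑ k, Real.exp (v k))) ≤
        Real.exp a / (1 + ∑ k, Real.exp (u k)) := by
    rw [mul_div_assoc', div_le_div_iff₀ hv hu, ← Real.exp_add]
    calc Real.exp (-(2 * ε) + b) * (1 + ∑ k, Real.exp (u k))
        ≤ Real.exp (-(2 * ε) + b) * (Real.exp ε * (1 + ∑ k, Real.exp (v k))) :=
          mul_le_mul_of_nonneg_left h1 (Real.exp_nonneg _)
      _ = Real.exp (b - ε) * (1 + ∑ k, Real.exp (v k)) := by
          rw [← mul_assoc, ← Real.exp_add]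
          congr 2
          ring
      _ ≤ _ := mul_le_mul_of_nonneg_right (Real.exp_le_exp.2 hab) hv.le
  have key0 := key (a := 0) (b := 0) (by linarith)
  rw [Real.exp_zero] at key0
  unfold mixtureDensity
  rw [mul_add, Finset.mul_sum]
  refine add_le_add (Finset.sum_le_sum fun j _ => ?_) ?_
  · rw [← mul_assoc]
    exact mul_le_mul_of_nonneg_right (key (by linarith [(abs_le.1 (h j)).1]))
      (gaussianDensity_nonneg _ _ _)
  · rw [← mul_assoc]
    exact mul_le_mul_of_nonneg_right key0 (gaussianDensity_nonneg _ _ _)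

/-- Logits for which the baseline component receives additional weight: if `g` are the logits of
weights `w`, then these are the logits of `(1 - ε) w`, the remaining weight `ε` being given to the
baseline. -/
noncomputable def liftedLogits (ε : ℝ) {m : ℕ} (g : Fin m → ℝ) (j : Fin m) : ℝ :=
  g j + Real.log ((1 - ε) / (1 + ε * ∑ k, Real.exp (g k)))

variable {ε : ℝ} (hε0 : 0 < ε) (hε1 : ε < 1)

include hε0 hε1 in
theorem softmax_liftedLogits {m : ℕ} (g : Fin m → ℝ) :
    (∀ j, Real.exp (liftedLogits ε g j) / (1 + ∑ k, Real.exp (liftedLogits ε g k)) =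
      (1 - ε) * (Real.exp (g j) / (1 + ∑ k, Real.exp (g k)))) ∧
    ε ≤ 1 / (1 + ∑ k, Real.exp (liftedLogits ε g k)) := by
  set S := ∑ k, Real.exp (g k) with hS
  have hS0 : 0 ≤ S := by positivity
  have h1 : 0 < 1 - ε := by linarith
  have h2 : 0 < 1 + ε * S := by positivity
  have he (j : Fin m) : Real.exp (liftedLogits ε g j) = Real.exp (g j) * ((1 - ε) / (1 + ε * S)) := by
    rw [liftedLogits, Real.exp_add, Real.exp_log (by positivity)]
  have hsum : 1 + ∑ k, Real.exp (liftedLogits ε g k) = (1 + S) / (1 + ε * S) := by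
    simp only [he]
    rw [← Finset.sum_mul, ← hS]
    field_simp
    ring
  rw [hsum]
  refine ⟨fun j => ?_, ?_⟩
  · rw [he]
    field_simp
  · rw [one_div_div, le_div_iff₀ (by positivity)]
    nlinarith

theorem PartitionData.volume_cell_pos {m : ℕ} (hm : 1 ≤ m) (j : Fin m) :
    0 < (volume : Measure (Vec D)) (A.cell m j) := by
  refine lt_of_lt_of_le ?_ (measure_mono (A.openCube_subset m j))
  refine IsOpen.measure_pos _ ?_ ⟨A.center m j, fun i => by simpa using A.h_pos m hm⟩
  have : openCube (A.center m j) (A.h m) = ⋂ i, {y | |y i - A.center m j i| < A.h m / 2} := by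
    ext y
    simp [openCube]
  rw [this]
  exact isOpen_iInter_of_finite fun i => isOpen_lt (by fun_prop) continuous_const

theorem PartitionData.measurableSet_iUnion_cell (m : ℕ) : MeasurableSet (⋃ j, A.cell m j) :=
  MeasurableSet.iUnion fun j => A.measurableSet_cell m j

theorem PartitionData.volume_remainder_pos (hD : 1 ≤ D) (m : ℕ) :
    0 < (volume : Measure (Vec D)) (A.remainder m) := by
  have hfin : (volume : Measure (Vec D)) (⋃ j, A.cell m j) < ∞ := by
    refine (measure_iUnion_le _).trans_lt ?_
    rw [tsum_fintype]
    refine ENNReal.sum_lt_top.2 fun j _ => ?_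
    refine (measure_mono fun y hy => ?_ : _ ≤ volume (Metric.closedBall (A.center m j) (D * A.h m))).trans_lt
      measure_closedBall_lt_top
    rw [mem_closedBall_iff_norm]
    exact norm_sub_le_of_mem_closedCube (A.subset_closedCube m j hy)
  have : Nonempty (Fin D) := ⟨⟨0, hD⟩⟩
  have huniv : (volume : Measure (Vec D)) Set.univ = ∞ := measure_univ_of_isAddLeftInvariant _
  rw [PartitionData.remainder, measure_compl (A.measurableSet_iUnion_cell m) hfin.ne, huniv,
    ENNReal.top_sub hfin.ne]
  exact ENNReal.zero_lt_top

/-- For an everywhere positive density the softmax of the exact log-odds gives the masses of the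
cells. -/
theorem softmax_logOdds {d : ℕ} (hD : 1 ≤ D) {m : ℕ} (hm : 1 ≤ m) {rho : Vec d → Vec D → ℝ≥0}
    {z : Vec d} (hint : Integrable fun y => (rho z y : ℝ)) (h1 : ∫ y, (rho z y : ℝ) = 1)
    (hpos : ∀ᵐ y, 0 < rho z y) (j : Fin m) :
    Real.exp (logOdds rho A m j z) / (1 + ∑ k, Real.exp (logOdds rho A m k z)) =
      ∫ y in A.cell m j, (rho z y : ℝ) := by
  have hp {s : Set (Vec D)} (hs : 0 < volume s) : 0 < ∫ y in s, (rho z y : ℝ) := by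
    rw [setIntegral_pos_iff_support_of_nonneg_ae (ae_of_all _ fun y => NNReal.coe_nonneg _)
      hint.integrableOn]
    have hsupp : (Function.support fun y => (rho z y : ℝ)) =ᵐ[volume] Set.univ := by
      rw [eventuallyEq_univ]
      filter_upwards [hpos] with y hy
      exact (NNReal.coe_pos.2 hy).ne'
    rw [measure_congr (hsupp.inter (ae_eq_refl s)), Set.univ_inter]
    exact hs
  have h0 := hp (A.volume_remainder_pos hD m)
  have hj (j : Fin m) := hp (A.volume_cell_pos hm j)
  have he (j : Fin m) : Real.exp (logOdds rho A m j z) =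
      (∫ y in A.cell m j, (rho z y : ℝ)) / ∫ y in A.remainder m, (rho z y : ℝ) := by
    rw [logOdds, Real.exp_log (div_pos (hj j) h0)]
  have hsum : ∑ k, (∫ y in A.cell m k, (rho z y : ℝ)) + ∫ y in A.remainder m, (rho z y : ℝ) = 1 := by
    rw [← integral_iUnion_fintype (fun j => A.measurableSet_cell m j) (A.disjoint_cell m)
      (fun j => hint.integrableOn), PartitionData.remainder,
      integral_add_compl (A.measurableSet_iUnion_cell m) hint, h1]
  simp only [he]
  rw [← Finset.sum_div]
  have : 1 + (∑ k, ∫ y in A.cell m k, (rho z y : ℝ)) / ∫ y in A.remainder m, (rho z y : ℝ) =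
      1 / ∫ y in A.remainder m, (rho z y : ℝ) := by
    rw [eq_div_iff h0.ne', add_mul, div_mul_cancel₀ _ h0.ne']
    linarith
  rw [this]
  field_simp

include hε0 hε1 in
/-- At the lifted log-odds, the mixture dominates both the mixture with the exact cell masses, up to
the factor `1 - ε`, and a fixed multiple of the broad Gaussian, which is independent of `m`. -/
theorem mixtureDensity_liftedLogits_ge {d : ℕ} (hD : 1 ≤ D) {m : ℕ} (hm : 1 ≤ m)
    {rho : Vec d → Vec D → ℝ≥0} {z : Vec d} (hint : Integrable fun y => (rho z y : ℝ))
    (h1 : ∫ y, (rho z y : ℝ) = 1) (hpos : ∀ᵐ y, 0 < rho z y) (y : Vec D) :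
    (1 - ε) * ∑ j, (∫ u in A.cell m j, (rho z u : ℝ)) * gaussianDensity (A.center m j) (A.σ m) y ≤
        mixtureDensity A m (liftedLogits ε fun j => logOdds rho A m j z) y ∧
      ε * gaussianDensity 0 A.σ0 y ≤
        mixtureDensity A m (liftedLogits ε fun j => logOdds rho A m j z) y := by
  obtain ⟨ha, hb⟩ := softmax_liftedLogits hε0 hε1 fun j => logOdds rho A m j z
  unfold mixtureDensity
  constructor
  · rw [Finset.mul_sum]
    refine le_add_of_le_of_nonneg (le_of_eq (Finset.sum_congr rfl fun j _ => ?_))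
      (mul_nonneg (hε0.le.trans hb) (gaussianDensity_nonneg _ _ _))
    rw [ha, softmax_logOdds A hD hm hint h1 hpos, mul_assoc]
  · refine le_add_of_nonneg_of_le (Finset.sum_nonneg fun j _ => mul_nonneg (by positivity)
      (gaussianDensity_nonneg _ _ _)) ?_
    exact mul_le_mul_of_nonneg_right hb (gaussianDensity_nonneg _ _ _)

include hε0 hε1 in
/-- Networks approximating the lifted log-odds. -/
theorem exists_net_liftedLogits {C : Type*} [MeasurableSpace C] {T : ℕ} {F : FeatureData C D T}
    {r : Fin T → ℝ} {A : (s : Fin T) → PartitionData D (r s)} {k : Fin T → ℕ}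
    (hL : SmoothLogOdds F A k) {s : Fin T} (hK : IsCompact (F.supp s)) {m : ℕ} (hm : 1 ≤ m) :
    ∃ a : ReLUNet (F.dim s) m, ∀ z ∈ F.supp s, ∀ j, |a.eval (fun i => z i) j -
      liftedLogits ε (fun j => logOdds (F.rho s) (A s) m j z) j| ≤ ε := by
  obtain ⟨ctr, l, -, hsub, hg⟩ := hL s
  choose U g hU hUs hgc hgeq using hg m hm
  have hcont (j : Fin m) : ContinuousOn (g j) (F.supp s) :=
    (hgc j).continuousOn.mono (hsub.trans (hUs j))
  have hlift (j : Fin m) : ContinuousOn (fun z => liftedLogits ε (fun j => g j z) j) (F.supp s) := by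
    unfold liftedLogits
    have hden (z : Vec (F.dim s)) : 0 < 1 + ε * ∑ k, Real.exp (g k z) := by positivity
    refine (hcont j).add (ContinuousOn.log (ContinuousOn.div continuousOn_const ?_ ?_) ?_)
    · exact continuousOn_const.add (continuousOn_const.mul
        (continuousOn_finsetSum _ fun k _ => (hcont k).rexp))
    · exact fun z _ => (hden z).ne'
    · exact fun z _ => (div_pos (by linarith) (hden z)).ne'
  obtain ⟨a, ha⟩ := exists_reLUNet_approx hK hlift hε0
  refine ⟨a, fun z hz j => ?_⟩
  have h := (ha z hz j).le
  have he : (fun j => g j z) = fun j => logOdds (F.rho s) (A s) m j z := by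
    funext j
    exact hgeq j z hz
  rwa [he] at h

end Mixture

/-! ### The forward chain -/

section ForwardChain

variable {C E : Type*} [MeasurableSpace C] [MeasurableSpace E]

theorem forwardPath_map_zero (κ : Kernel C E) [IsMarkovKernel κ] : ∀ (T : ℕ)
    (q : Fin T → Kernel E E) [∀ s, IsMarkovKernel (q s)],
    (forwardPath κ T q).map (fun x => x 0) = κ := by
  intro T
  induction T with
  | zero =>
    intro q _
    rw [forwardPath, ← Kernel.map_comp_right _ (by fun_prop) (by fun_prop)]
    exact Kernel.map_id' _
  | succ T ih =>
    intro q _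
    have h : (fun x : Fin (T + 2) → E => x 0) ∘ (fun p : (Fin (T + 1) → E) × E =>
        (Fin.snoc p.1 p.2 : Fin (T + 2) → E)) = (fun x => x 0) ∘ Prod.fst := by
      funext p
      exact Fin.snoc_castSucc (α := fun _ => E) p.2 p.1 0
    rw [forwardPath, ← Kernel.map_comp_right _ (measurable_snoc T) (by fun_prop), h,
      Kernel.map_comp_right _ (by fun_prop) (by fun_prop), ← Kernel.fst_eq, Kernel.fst_compProd]
    exact ih _

/-- Along the forward path, the state at time `s + 1` is drawn from `q s` given the state at
time `s`. -/
theorem lintegral_forwardPath_pair (κ : Kernel C E) [IsMarkovKernel κ] (c : C)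
    {f : E → E → ℝ≥0∞} (hf : Measurable (Function.uncurry f)) : ∀ (T : ℕ)
    (q : Fin T → Kernel E E) [∀ s, IsMarkovKernel (q s)] (s : Fin T),
    ∫⁻ w, f (w s.castSucc) (w s.succ) ∂(forwardPath κ T q c) =
      ∫⁻ w, ∫⁻ x, f (w s.castSucc) x ∂(q s (w s.castSucc)) ∂(forwardPath κ T q c) := by
  intro T
  induction T with
  | zero => exact fun q _ s => s.elim0
  | succ T ih =>
    intro q _ s
    -- integrals over the extended path are iterated integrals
    have hstep (F : (Fin (T + 2) → E) → ℝ≥0∞) (hF : Measurable F) :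
        ∫⁻ w, F w ∂(forwardPath κ (T + 1) q c) =
          ∫⁻ w, ∫⁻ x, F (Fin.snoc w x) ∂(q (Fin.last T) (w (Fin.last T)))
            ∂(forwardPath κ T (fun s => q s.castSucc) c) := by
      have hF' : Measurable fun p : (Fin (T + 1) → E) × E => F (Fin.snoc p.1 p.2) :=
        hF.comp (measurable_snoc T)
      rw [forwardPath, Kernel.map_apply _ (measurable_snoc T), lintegral_map hF (measurable_snoc T),
        Kernel.lintegral_compProd _ _ _ hF']
      rfl
    have hpair (s : Fin (T + 1)) :
        Measurable fun w : Fin (T + 2) → E => f (w s.castSucc) (w s.succ) := by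
      have h : Measurable fun w : Fin (T + 2) → E => (w s.castSucc, w s.succ) := by fun_prop
      exact hf.comp h
    have hin (s : Fin (T + 1)) :
        Measurable fun w : Fin (T + 2) → E => ∫⁻ x, f (w s.castSucc) x ∂(q s (w s.castSucc)) := by
      have h : Measurable fun y => ∫⁻ x, f y x ∂(q s y) := hf.lintegral_kernel_prod_right
      exact h.comp (measurable_pi_apply _)
    rw [hstep _ (hpair s), hstep _ (hin s)]
    refine Fin.lastCases ?_ (fun s => ?_) s
    · simp [Fin.succ_last]
    · simp only [Fin.succ_castSucc, Fin.snoc_castSucc, lintegral_const, measure_univ, mul_one]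
      exact ih (fun s => q s.castSucc) s

end ForwardChain

namespace DiffusionProblem

variable {C : Type*} [MeasurableSpace C] {D T : ℕ} (S : DiffusionProblem C D T)

instance (s : Fin (T + 1)) : IsMarkovKernel (S.fwdMarginal s) :=
  Kernel.IsMarkovKernel.map _ (by fun_prop)

theorem fwdMarginal_zero : S.fwdMarginal 0 = S.target :=
  forwardPath_map_zero S.target T S.fwd

theorem lintegral_fwdMarginal (s : Fin (T + 1)) (c : C) {f : Vec D → ℝ≥0∞} (hf : Measurable f) :
    ∫⁻ y, f y ∂(S.fwdMarginal s c) = ∫⁻ w, f (w s) ∂(S.fwdPath c) := by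
  rw [fwdMarginal, Kernel.map_apply _ (by fun_prop), lintegral_map hf (by fun_prop)]

theorem lintegral_fwd (s : Fin T) (y : Vec D) {f : Vec D → ℝ≥0∞} (hf : Measurable f) :
    ∫⁻ x, f x ∂(S.fwd s y) = ∫⁻ x, (S.fwdDensity s y x : ℝ≥0∞) * f x := by
  have hm : Measurable fun x => (S.fwdDensity s y x : ℝ≥0∞) :=
    ((S.measurable_fwdDensity s).of_uncurry_left (x := y)).coe_nnreal_ennreal
  rw [S.fwd_eq, lintegral_withDensity_eq_lintegral_mul _ hm hf]
  rfl

theorem marginalDensity_succ (s : Fin T) (c : C) (u : Vec D) : S.marginalDensity s.succ c u =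
    ∫⁻ v, (S.fwdDensity s v u : ℝ≥0∞) ∂(S.fwdMarginal s.castSucc c) := rfl

theorem measurable_marginalDensity (s : Fin (T + 1)) :
    Measurable (Function.uncurry (S.marginalDensity s)) := by
  refine Fin.cases ?_ (fun s => ?_) s
  · exact S.measurable_targetDensity.coe_nnreal_ennreal
  · let κ : Kernel (C × Vec D) (Vec D) := (S.fwdMarginal s.castSucc).comap Prod.fst measurable_fst
    have h : Measurable (Function.uncurry fun (p : C × Vec D) (v : Vec D) =>
        (S.fwdDensity s v p.2 : ℝ≥0∞)) := by
      have h2 : Measurable fun z : (C × Vec D) × Vec D => (z.2, z.1.2) := by fun_prop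
      exact ((S.measurable_fwdDensity s).comp h2).coe_nnreal_ennreal
    exact h.lintegral_kernel_prod_right (κ := κ)

theorem fwdMarginal_eq (s : Fin (T + 1)) : ∀ᵐ c ∂S.ctxLaw,
    S.fwdMarginal s c = volume.withDensity (S.marginalDensity s c) := by
  refine Fin.cases ?_ (fun s => ?_) s
  · rw [S.fwdMarginal_zero]
    exact S.target_eq
  · refine ae_of_all _ fun c => ?_
    have hq : Measurable fun z : Vec D × Vec D => (S.fwdDensity s z.1 z.2 : ℝ≥0∞) :=
      (S.measurable_fwdDensity s).coe_nnreal_ennreal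
    ext t ht
    have hind : Measurable (t.indicator (1 : Vec D → ℝ≥0∞)) := measurable_one.indicator ht
    have hin : Measurable fun y => ∫⁻ x, t.indicator (1 : Vec D → ℝ≥0∞) x ∂(S.fwd s y) :=
      hind.lintegral_kernel
    calc S.fwdMarginal s.succ c t
        = ∫⁻ x, t.indicator 1 x ∂(S.fwdMarginal s.succ c) := (lintegral_indicator_one ht).symm
      _ = ∫⁻ w, t.indicator 1 (w s.succ) ∂(S.fwdPath c) := S.lintegral_fwdMarginal _ _ hind
      _ = ∫⁻ w, ∫⁻ x, t.indicator 1 x ∂(S.fwd s (w s.castSucc)) ∂(S.fwdPath c) :=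
          lintegral_forwardPath_pair S.target c (f := fun _ x => t.indicator 1 x)
            (hind.comp measurable_snd) T S.fwd s
      _ = ∫⁻ y, ∫⁻ x, t.indicator 1 x ∂(S.fwd s y) ∂(S.fwdMarginal s.castSucc c) :=
          (S.lintegral_fwdMarginal _ _ hin).symm
      _ = ∫⁻ y, (∫⁻ x, (S.fwdDensity s y x : ℝ≥0∞) * t.indicator 1 x)
            ∂(S.fwdMarginal s.castSucc c) := by simp only [S.lintegral_fwd s _ hind]
      _ = ∫⁻ x, ∫⁻ y, (S.fwdDensity s y x : ℝ≥0∞) * t.indicator 1 x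
            ∂(S.fwdMarginal s.castSucc c) :=
          lintegral_lintegral_swap (hq.mul (hind.comp measurable_snd)).aemeasurable
      _ = ∫⁻ x, t.indicator (S.marginalDensity s.succ c) x := by
          refine lintegral_congr fun x => ?_
          by_cases hx : x ∈ t <;> simp [hx, marginalDensity_succ]
      _ = volume.withDensity (S.marginalDensity s.succ c) t := by
          rw [lintegral_indicator ht, withDensity_apply _ ht]

theorem lintegral_fwdMarginal_eq (s : Fin (T + 1)) {c : C}
    (hc : S.fwdMarginal s c = volume.withDensity (S.marginalDensity s c))
    {f : Vec D → ℝ≥0∞} (hf : Measurable f) :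
    ∫⁻ y, f y ∂(S.fwdMarginal s c) = ∫⁻ y, S.marginalDensity s c y * f y := by
  rw [hc, lintegral_withDensity_eq_lintegral_mul _
    (S.measurable_marginalDensity s).of_uncurry_left hf]
  rfl

theorem lintegral_stepJoint_path (s : Fin T) {f : C × Vec D × Vec D → ℝ≥0∞} (hf : Measurable f) :
    ∫⁻ p, f p ∂(S.stepJoint s) =
      ∫⁻ c, ∫⁻ w, f (c, w s.castSucc, w s.succ) ∂(S.fwdPath c) ∂S.ctxLaw := by
  have hm : Measurable fun p : C × (Fin (T + 1) → Vec D) => (p.1, p.2 s.castSucc, p.2 s.succ) := by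
    fun_prop
  have hm' : Measurable fun p : C × (Fin (T + 1) → Vec D) =>
    f (p.1, p.2 s.castSucc, p.2 s.succ) := hf.comp hm
  rw [stepJoint, lintegral_map hf hm, pathJoint, Measure.lintegral_compProd hm']

theorem lintegral_stepJoint_fst (s : Fin T) {f : C → Vec D → ℝ≥0∞}
    (hf : Measurable (Function.uncurry f)) :
    ∫⁻ p, f p.1 p.2.1 ∂(S.stepJoint s) =
      ∫⁻ c, ∫⁻ y, f c y ∂(S.fwdMarginal s.castSucc c) ∂S.ctxLaw := by
  have h : Measurable fun p : C × Vec D × Vec D => f p.1 p.2.1 :=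
    hf.comp (by fun_prop : Measurable fun p : C × Vec D × Vec D => (p.1, p.2.1))
  rw [S.lintegral_stepJoint_path s h]
  refine lintegral_congr fun c => ?_
  rw [S.lintegral_fwdMarginal _ _ hf.of_uncurry_left]

theorem lintegral_stepJoint_snd (s : Fin T) {f : C → Vec D → ℝ≥0∞}
    (hf : Measurable (Function.uncurry f)) :
    ∫⁻ p, f p.1 p.2.2 ∂(S.stepJoint s) =
      ∫⁻ c, ∫⁻ x, f c x ∂(S.fwdMarginal s.succ c) ∂S.ctxLaw := by
  have h : Measurable fun p : C × Vec D × Vec D => f p.1 p.2.2 :=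
    hf.comp (by fun_prop : Measurable fun p : C × Vec D × Vec D => (p.1, p.2.2))
  rw [S.lintegral_stepJoint_path s h]
  refine lintegral_congr fun c => ?_
  rw [S.lintegral_fwdMarginal _ _ hf.of_uncurry_left]

/-- The measure `P_C ⊗ dy ⊗ dx`, with respect to which the law of `(C, X_s, X_{s+1})` has a
density. -/
noncomputable def refMeasure : Measure (C × Vec D × Vec D) := S.ctxLaw.prod (volume.prod volume)

/-- The joint density of `(C, X_s, X_{s+1})` in the order of the forward chain. -/
theorem stepJoint_eq_forward (s : Fin T) : S.stepJoint s = S.refMeasure.withDensity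
    fun p => S.marginalDensity s.castSucc p.1 p.2.1 * (S.fwdDensity s p.2.1 p.2.2 : ℝ≥0∞) := by
  have hμ : Measurable fun p : C × Vec D × Vec D => S.marginalDensity s.castSucc p.1 p.2.1 :=
    (S.measurable_marginalDensity s.castSucc).comp
      (by fun_prop : Measurable fun p : C × Vec D × Vec D => (p.1, p.2.1))
  have hq : Measurable fun p : C × Vec D × Vec D => (S.fwdDensity s p.2.1 p.2.2 : ℝ≥0∞) :=
    ((S.measurable_fwdDensity s).comp measurable_snd).coe_nnreal_ennreal
  ext t ht
  have hd : Measurable fun p : C × Vec D × Vec D =>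
    S.marginalDensity s.castSucc p.1 p.2.1 * (S.fwdDensity s p.2.1 p.2.2 : ℝ≥0∞) := hμ.mul hq
  have hind : Measurable (t.indicator (1 : C × Vec D × Vec D → ℝ≥0∞)) := measurable_one.indicator ht
  rw [← lintegral_indicator_one ht, S.lintegral_stepJoint_path s hind,
    ← lintegral_indicator_one (μ := S.refMeasure.withDensity _) ht,
    lintegral_withDensity_eq_lintegral_mul _ hd hind, refMeasure,
    lintegral_prod _ (hd.mul hind).aemeasurable]
  refine lintegral_congr_ae ?_
  filter_upwards [S.fwdMarginal_eq s.castSucc] with c hc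
  have hindc : Measurable (Function.uncurry fun y x => t.indicator (1 : C × Vec D × Vec D → ℝ≥0∞)
      (c, y, x)) := hind.comp measurable_prodMk_left
  have hin : Measurable fun y => ∫⁻ x, t.indicator (1 : C × Vec D × Vec D → ℝ≥0∞) (c, y, x)
      ∂(S.fwd s y) := hindc.lintegral_kernel_prod_right
  have hprod : Measurable fun z : Vec D × Vec D => S.marginalDensity s.castSucc c z.1 *
      (S.fwdDensity s z.1 z.2 : ℝ≥0∞) * t.indicator (1 : C × Vec D × Vec D → ℝ≥0∞) (c, z) :=
    (hd.mul hind).comp measurable_prodMk_left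
  refine Eq.trans ?_ (lintegral_prod _ hprod.aemeasurable).symm
  calc ∫⁻ w, t.indicator 1 (c, w s.castSucc, w s.succ) ∂(S.fwdPath c)
      = ∫⁻ w, ∫⁻ x, t.indicator 1 (c, w s.castSucc, x) ∂(S.fwd s (w s.castSucc)) ∂(S.fwdPath c) :=
        lintegral_forwardPath_pair S.target c hindc T S.fwd s
    _ = ∫⁻ y, ∫⁻ x, t.indicator 1 (c, y, x) ∂(S.fwd s y) ∂(S.fwdMarginal s.castSucc c) :=
        (S.lintegral_fwdMarginal _ _ hin).symm
    _ = ∫⁻ y, S.marginalDensity s.castSucc c y * ∫⁻ x, t.indicator 1 (c, y, x) ∂(S.fwd s y) :=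
        S.lintegral_fwdMarginal_eq _ hc hin
    _ = _ := by
        refine lintegral_congr fun y => ?_
        rw [S.lintegral_fwd s y hindc.of_uncurry_left, ← lintegral_const_mul]
        · refine lintegral_congr fun x => ?_
          ring
        · exact (((S.measurable_fwdDensity s).of_uncurry_left (x := y)).coe_nnreal_ennreal).mul
            hindc.of_uncurry_left

theorem stepInput_eq (s : Fin T) : S.stepInput s = S.ctxLaw ⊗ₘ S.fwdMarginal s.succ := by
  ext t ht
  have hm : Measurable fun p : C × Vec D × Vec D => (p.1, p.2.2) := by fun_prop
  have hind : Measurable (t.indicator (1 : C × Vec D → ℝ≥0∞)) := measurable_one.indicator ht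
  rw [← lintegral_indicator_one ht, ← lintegral_indicator_one (μ := S.ctxLaw ⊗ₘ _) ht,
    Measure.lintegral_compProd hind, stepInput, lintegral_map hind hm]
  exact S.lintegral_stepJoint_snd s (f := fun c x => t.indicator 1 (c, x)) hind

instance (s : Fin T) : IsProbabilityMeasure (S.stepInput s) :=
  Measure.isProbabilityMeasure_map (by fun_prop)

/-- The law of `((C, X_{s+1}), X_s)`. -/
noncomputable def reverseJoint (s : Fin T) : Measure ((C × Vec D) × Vec D) :=
  (S.stepJoint s).map fun p => ((p.1, p.2.2), p.2.1)

instance (s : Fin T) : IsProbabilityMeasure (S.reverseJoint s) :=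
  Measure.isProbabilityMeasure_map (by fun_prop)

instance (s : Fin T) : IsMarkovKernel (S.trueReverse s) := by
  unfold trueReverse
  infer_instance

theorem stepInput_compProd_trueReverse (s : Fin T) :
    S.stepInput s ⊗ₘ S.trueReverse s = S.reverseJoint s := by
  have h : S.stepInput s = (S.reverseJoint s).fst := by
    rw [stepInput, reverseJoint, Measure.fst, Measure.map_map (by fun_prop) (by fun_prop)]
    rfl
  have h' : S.trueReverse s = (S.reverseJoint s).condKernel := rfl
  rw [h, h']
  exact (S.reverseJoint s).disintegrate _

/-- The true reverse kernels generate the forward marginals backwards in time. -/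
theorem compProd_fwdMarginal_castSucc (s : Fin T) : S.ctxLaw ⊗ₘ S.fwdMarginal s.castSucc =
    ((S.ctxLaw ⊗ₘ S.fwdMarginal s.succ) ⊗ₘ S.trueReverse s).map (fun z => (z.1.1, z.2)) := by
  rw [← stepInput_eq, stepInput_compProd_trueReverse, reverseJoint,
    Measure.map_map (by fun_prop) (by fun_prop)]
  ext t ht
  have hm : Measurable ((fun z : (C × Vec D) × Vec D => (z.1.1, z.2)) ∘
      fun p : C × Vec D × Vec D => ((p.1, p.2.2), p.2.1)) := by fun_prop
  have hind : Measurable (t.indicator (1 : C × Vec D → ℝ≥0∞)) := measurable_one.indicator ht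
  rw [← lintegral_indicator_one ht, Measure.lintegral_compProd hind,
    ← lintegral_indicator_one ht, lintegral_map hind hm]
  exact (S.lintegral_stepJoint_fst s (f := fun c y => t.indicator 1 (c, y)) hind).symm

end DiffusionProblem

/-! ### Bayes' formula and the reverse density -/

section ReverseDensity

/-- A log-variation bound in product form. -/
theorem le_mul_of_log_div_iInf_le {X : Type*} {f : X → ℝ≥0∞} {s : Set X} {x : ℝ≥0∞} {a : ℝ}
    (h : ENNReal.log (x / ⨅ y ∈ s, f y) ≤ (a : EReal)) {w : X} (hw : w ∈ s) :
    x ≤ ENNReal.ofReal (Real.exp a) * f w := by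
  have h1 : x / ⨅ y ∈ s, f y ≤ ENNReal.ofReal (Real.exp a) := by
    rw [← ENNReal.log_le_log_iff, ENNReal.log_ofReal_of_pos (Real.exp_pos a), Real.log_exp]
    exact h
  have h2 : ENNReal.ofReal (Real.exp a) ≠ 0 := (ENNReal.ofReal_pos.2 (Real.exp_pos a)).ne'
  rw [ENNReal.div_le_iff_le_mul (.inr ENNReal.ofReal_ne_top) (.inr h2)] at h1
  exact h1.trans (mul_le_mul_right (iInf₂_le w hw) _)

variable {C : Type*} [MeasurableSpace C] {D T : ℕ} {S : DiffusionProblem C D T}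
  {F : FeatureData C D T} {r : Fin T → ℝ}

namespace DiffusionProblem

theorem stepInput_eq_withDensity (S : DiffusionProblem C D T) (s : Fin T) :
    S.stepInput s = (S.ctxLaw.prod volume).withDensity
      (Function.uncurry (S.marginalDensity s.succ)) := by
  have hd := S.measurable_marginalDensity s.succ
  rw [stepInput_eq]
  ext t ht
  have hind : Measurable (t.indicator (1 : C × Vec D → ℝ≥0∞)) := measurable_one.indicator ht
  rw [← lintegral_indicator_one ht, ← lintegral_indicator_one ht, Measure.lintegral_compProd hind,
    lintegral_withDensity_eq_lintegral_mul _ hd hind, lintegral_prod _ (hd.mul hind).aemeasurable]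
  refine lintegral_congr_ae ?_
  filter_upwards [S.fwdMarginal_eq s.succ] with c hc
  exact S.lintegral_fwdMarginal_eq _ hc (hind.comp measurable_prodMk_left)

theorem ae_stepInput_of_ae_ctxLaw (S : DiffusionProblem C D T) (s : Fin T) {p : C → Prop}
    (h : ∀ᵐ c ∂S.ctxLaw, p c) :
    ∀ᵐ q ∂S.stepInput s, p q.1 := by
  have hm : MeasurePreserving Prod.fst (S.stepInput s) S.ctxLaw :=
    ⟨measurable_fst, by rw [stepInput_eq]; exact Measure.fst_compProd _ _⟩
  exact hm.quasiMeasurePreserving.ae h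

/-- Almost sure statements for the reference measure, in the order of the reverse chain. -/
theorem ae_stepInput_of_ae_refMeasure (S : DiffusionProblem C D T) (s : Fin T)
    {p : C × Vec D × Vec D → Prop} (h : ∀ᵐ x ∂S.refMeasure, p x) :
    ∀ᵐ q ∂S.stepInput s, ∀ᵐ y, p (q.1, y, q.2) := by
  have hm : MeasurePreserving (fun z : (C × Vec D) × Vec D => (z.1.1, z.2, z.1.2))
      ((S.ctxLaw.prod volume).prod volume) S.refMeasure :=
    ((MeasurePreserving.id S.ctxLaw).prod
      (Measure.measurePreserving_swap (μ := (volume : Measure (Vec D)))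
        (ν := (volume : Measure (Vec D))))).comp
      (measurePreserving_prodAssoc S.ctxLaw (volume : Measure (Vec D)) (volume : Measure (Vec D)))
  have h1 := Measure.ae_ae_of_ae_prod (hm.quasiMeasurePreserving.ae h)
  rw [stepInput_eq_withDensity]
  exact (withDensity_absolutelyContinuous _ _).ae_le h1

theorem ae_marginalDensity_ne_top (S : DiffusionProblem C D T) (s : Fin T) :
    ∀ᵐ q ∂S.stepInput s, S.marginalDensity s.succ q.1 q.2 ≠ ∞ := by
  have h1 : ∫⁻ q, Function.uncurry (S.marginalDensity s.succ) q ∂(S.ctxLaw.prod volume) = 1 := by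
    rw [← setLIntegral_univ, ← withDensity_apply _ MeasurableSet.univ, ← stepInput_eq_withDensity,
      measure_univ]
  rw [stepInput_eq_withDensity]
  refine (withDensity_absolutelyContinuous _ _).ae_le ?_
  filter_upwards [ae_lt_top (S.measurable_marginalDensity s.succ) (by rw [h1]; simp)] with q hq
  exact hq.ne

end DiffusionProblem

theorem RegularityAssumption.marginalDensity_pos (hR : RegularityAssumption S r)
    (s : Fin (T + 1)) : ∀ᵐ c ∂S.ctxLaw, ∀ u, S.marginalDensity s c u ≠ 0 := by
  refine Fin.cases ?_ (fun s => ?_) s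
  · filter_upwards [hR.target_pos] with c hc u
    exact ENNReal.coe_ne_zero.2 (hc u).ne'
  · refine ae_of_all _ fun c u => ?_
    have hm : Measurable fun v => (S.fwdDensity s v u : ℝ≥0∞) :=
      ((S.measurable_fwdDensity s).comp measurable_prodMk_right).coe_nnreal_ennreal
    have hsupp : (Function.support fun v => (S.fwdDensity s v u : ℝ≥0∞)) = Set.univ :=
      Set.eq_univ_of_forall fun v => ENNReal.coe_ne_zero.2 (hR.fwd_pos s v u).ne'
    rw [S.marginalDensity_succ, ← pos_iff_ne_zero, lintegral_pos_iff_support hm, hsupp,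
      measure_univ]
    exact one_pos

theorem FeatureData.measurable_rho_comp (F : FeatureData C D T) (s : Fin T) :
    Measurable fun z : (C × Vec D) × Vec D => F.rho s (F.phi s z.1) z.2 := by
  have h := F.measurable_phi s
  exact (F.measurable_rho s).comp
    (by fun_prop : Measurable fun z : (C × Vec D) × Vec D => (F.phi s z.1, z.2))

theorem FeatureData.measurable_rho_step (F : FeatureData C D T) (s : Fin T) :
    Measurable fun p : C × Vec D × Vec D => F.rho s (F.phi s (p.1, p.2.2)) p.2.1 :=
  (F.measurable_rho_comp s).comp
    (by fun_prop : Measurable fun p : C × Vec D × Vec D => ((p.1, p.2.2), p.2.1))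

namespace FeatureAssumption

theorem lintegral_stepJoint (hF : FeatureAssumption S F) (s : Fin T)
    {f : C × Vec D × Vec D → ℝ≥0∞} (hf : Measurable f) :
    ∫⁻ p, f p ∂(S.stepJoint s) =
      ∫⁻ q, (∫⁻ y, (F.rho s (F.phi s q) y : ℝ≥0∞) * f (q.1, y, q.2)) ∂(S.stepInput s) := by
  have hm : Measurable fun z : (C × Vec D) × Vec D => (z.1.1, z.2, z.1.2) := by fun_prop
  have hf' : Measurable fun z : (C × Vec D) × Vec D => f (z.1.1, z.2, z.1.2) := hf.comp hm
  have h1 : ∫⁻ p, f p ∂(S.stepJoint s) =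
      ∫⁻ z, f (z.1.1, z.2, z.1.2) ∂(S.reverseJoint s) := by
    rw [DiffusionProblem.reverseJoint, lintegral_map hf' (by fun_prop)]
  rw [h1, ← S.stepInput_compProd_trueReverse, Measure.lintegral_compProd hf']
  refine lintegral_congr_ae ?_
  filter_upwards [hF.sufficiency s] with q hq
  have hρ : Measurable fun y => (F.rho s (F.phi s q) y : ℝ≥0∞) :=
    ((F.measurable_rho_comp s).comp measurable_prodMk_left).coe_nnreal_ennreal
  have hfq : Measurable fun y => f (q.1, y, q.2) := hf'.comp measurable_prodMk_left
  rw [hq, lintegral_withDensity_eq_lintegral_mul _ hρ hfq]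
  rfl

theorem stepJoint_eq_reverse (hF : FeatureAssumption S F) (s : Fin T) :
    S.stepJoint s = S.refMeasure.withDensity fun p =>
      S.marginalDensity s.succ p.1 p.2.2 * (F.rho s (F.phi s (p.1, p.2.2)) p.2.1 : ℝ≥0∞) := by
  have hμ : Measurable fun p : C × Vec D × Vec D => S.marginalDensity s.succ p.1 p.2.2 :=
    (S.measurable_marginalDensity s.succ).comp
      (by fun_prop : Measurable fun p : C × Vec D × Vec D => (p.1, p.2.2))
  have hρ := (F.measurable_rho_step s).coe_nnreal_ennreal
  have hd : Measurable fun p : C × Vec D × Vec D => S.marginalDensity s.succ p.1 p.2.2 *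
    (F.rho s (F.phi s (p.1, p.2.2)) p.2.1 : ℝ≥0∞) := hμ.mul hρ
  ext t ht
  have hind : Measurable (t.indicator (1 : C × Vec D × Vec D → ℝ≥0∞)) := measurable_one.indicator ht
  have hm : Measurable fun z : (C × Vec D) × Vec D => (z.1.1, z.2, z.1.2) := by fun_prop
  have hin : Measurable fun q : C × Vec D => ∫⁻ y, (F.rho s (F.phi s q) y : ℝ≥0∞) *
      t.indicator (1 : C × Vec D × Vec D → ℝ≥0∞) (q.1, y, q.2) :=
    ((F.measurable_rho_comp s).coe_nnreal_ennreal.mul (hind.comp hm)).lintegral_prod_right'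
  rw [← lintegral_indicator_one ht, hF.lintegral_stepJoint s hind, S.stepInput_eq_withDensity,
    lintegral_withDensity_eq_lintegral_mul _ (S.measurable_marginalDensity s.succ) hin,
    lintegral_prod _ ((S.measurable_marginalDensity s.succ).mul hin).aemeasurable,
    ← lintegral_indicator_one (μ := S.refMeasure.withDensity _) ht,
    lintegral_withDensity_eq_lintegral_mul _ hd hind, DiffusionProblem.refMeasure,
    lintegral_prod _ (hd.mul hind).aemeasurable]
  refine lintegral_congr fun c => ?_
  have hprod : Measurable fun z : Vec D × Vec D => S.marginalDensity s.succ c z.2 *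
      (F.rho s (F.phi s (c, z.2)) z.1 : ℝ≥0∞) *
      t.indicator (1 : C × Vec D × Vec D → ℝ≥0∞) (c, z) :=
    (hd.mul hind).comp measurable_prodMk_left
  refine Eq.trans ?_ (lintegral_prod_symm _ hprod.aemeasurable).symm
  refine lintegral_congr fun x => ?_
  have hy : Measurable fun y => (F.rho s (F.phi s (c, x)) y : ℝ≥0∞) *
      t.indicator (1 : C × Vec D × Vec D → ℝ≥0∞) (c, y, x) :=
    ((F.measurable_rho_comp s).comp measurable_prodMk_left).coe_nnreal_ennreal.mul
      (hind.comp (by fun_prop : Measurable fun y : Vec D => (c, y, x)))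
  simp only [Pi.mul_apply, Function.uncurry, mul_assoc]
  rw [lintegral_const_mul _ hy]

/-- Bayes' formula for the reverse density. -/
theorem bayes (hF : FeatureAssumption S F) (s : Fin T) : ∀ᵐ q ∂S.stepInput s, ∀ᵐ y,
    S.marginalDensity s.succ q.1 q.2 * (F.rho s (F.phi s q) y : ℝ≥0∞) =
      S.marginalDensity s.castSucc q.1 y * (S.fwdDensity s y q.2 : ℝ≥0∞) := by
  refine S.ae_stepInput_of_ae_refMeasure s (p := fun p =>
    S.marginalDensity s.succ p.1 p.2.2 * (F.rho s (F.phi s (p.1, p.2.2)) p.2.1 : ℝ≥0∞) =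
      S.marginalDensity s.castSucc p.1 p.2.1 * (S.fwdDensity s p.2.1 p.2.2 : ℝ≥0∞)) ?_
  have h1 : Measurable fun p : C × Vec D × Vec D => S.marginalDensity s.succ p.1 p.2.2 *
      (F.rho s (F.phi s (p.1, p.2.2)) p.2.1 : ℝ≥0∞) :=
    ((S.measurable_marginalDensity s.succ).comp
      (by fun_prop : Measurable fun p : C × Vec D × Vec D => (p.1, p.2.2))).mul
      (F.measurable_rho_step s).coe_nnreal_ennreal
  have h2 : Measurable fun p : C × Vec D × Vec D => S.marginalDensity s.castSucc p.1 p.2.1 *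
      (S.fwdDensity s p.2.1 p.2.2 : ℝ≥0∞) :=
    ((S.measurable_marginalDensity s.castSucc).comp
      (by fun_prop : Measurable fun p : C × Vec D × Vec D => (p.1, p.2.1))).mul
      ((S.measurable_fwdDensity s).comp measurable_snd).coe_nnreal_ennreal
  have : SigmaFinite S.refMeasure := by
    unfold DiffusionProblem.refMeasure
    infer_instance
  refine (withDensity_eq_iff_of_sigmaFinite h1.aemeasurable h2.aemeasurable).1 ?_
  rw [← hF.stepJoint_eq_reverse, ← S.stepJoint_eq_forward]

theorem ae_mem_supp (hF : FeatureAssumption S F) (s : Fin T) :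
    ∀ᵐ q ∂S.stepInput s, F.phi s q ∈ F.supp s := by
  have hφ := F.measurable_phi s
  have h : (S.stepInput s).map (F.phi s) = featureLaw S F s := by
    rw [featureLaw, featureJoint, Measure.snd, DiffusionProblem.stepInput,
      Measure.map_map hφ (by fun_prop), Measure.map_map measurable_snd (by fun_prop)]
    rfl
  have hK : MeasurableSet (F.supp s) := (hF.isCompact_supp s).isClosed.measurableSet
  have h1 : S.stepInput s (F.phi s ⁻¹' F.supp s) = 1 := by
    rw [← Measure.map_apply hφ hK, h, hF.featureLaw_supp]
  exact (mem_ae_iff_prob_eq_one (hφ hK)).2 h1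

theorem ae_lintegral_rho (hF : FeatureAssumption S F) (s : Fin T) :
    ∀ᵐ q ∂S.stepInput s, ∫⁻ y, (F.rho s (F.phi s q) y : ℝ≥0∞) = 1 := by
  filter_upwards [hF.sufficiency s] with q hq
  have h := measure_univ (μ := S.trueReverse s q)
  rwa [hq, withDensity_apply _ MeasurableSet.univ, setLIntegral_univ] at h

theorem ae_rho_pos (hF : FeatureAssumption S F) (hR : RegularityAssumption S r) (s : Fin T) :
    ∀ᵐ q ∂S.stepInput s, ∀ᵐ y, 0 < F.rho s (F.phi s q) y := by
  filter_upwards [hF.bayes s, S.ae_stepInput_of_ae_ctxLaw s (hR.marginalDensity_pos s.castSucc)]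
    with q hb hpos
  filter_upwards [hb] with y hy
  have h : S.marginalDensity s.castSucc q.1 y * (S.fwdDensity s y q.2 : ℝ≥0∞) ≠ 0 :=
    mul_ne_zero (hpos y) (ENNReal.coe_ne_zero.2 (hR.fwd_pos s y q.2).ne')
  rw [← hy] at h
  exact pos_iff_ne_zero.2 (ENNReal.coe_ne_zero.1 (right_ne_zero_of_mul h))

/-- The reverse density is bounded by the exponential of the log-variation bounds: by Bayes'
formula it varies by at most this factor over a cube of side length `r s`, and it integrates to
one. -/
theorem rho_le (hF : FeatureAssumption S F) (hR : RegularityAssumption S r) (s : Fin T)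
    {ctr : Vec D → Vec D} {a : Vec D → ℝ≥0} {b : Vec D → Vec D → ℝ≥0}
    (ha : ∀ᵐ c ∂S.ctxLaw, ∀ᵐ x ∂(volume : Measure (Vec D)),
      ENNReal.log (S.marginalDensity s.castSucc c x /
        ⨅ y ∈ closedCube (ctr x) (r s), S.marginalDensity s.castSucc c y) ≤ ((a x : ℝ) : EReal))
    (hb : ∀ᵐ p ∂((volume : Measure (Vec D)).prod (volume : Measure (Vec D))),
      ENNReal.log ((S.fwdDensity s p.1 p.2 : ℝ≥0∞) /
        ⨅ y ∈ closedCube (ctr p.1) (r s), (S.fwdDensity s y p.2 : ℝ≥0∞))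
        ≤ ((b p.1 p.2 : ℝ) : EReal)) :
    ∀ᵐ q ∂S.stepInput s, ∀ᵐ y, (F.rho s (F.phi s q) y : ℝ) ≤
      Real.exp (a y + b y q.2) /
        (volume : Measure (Vec D)).real (Metric.closedBall 0 (r s / 2)) := by
  have hb' : ∀ᵐ p ∂S.refMeasure, ENNReal.log ((S.fwdDensity s p.2.1 p.2.2 : ℝ≥0∞) /
        ⨅ y ∈ closedCube (ctr p.2.1) (r s), (S.fwdDensity s y p.2.2 : ℝ≥0∞))
        ≤ ((b p.2.1 p.2.2 : ℝ) : EReal) := Measure.quasiMeasurePreserving_snd.ae hb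
  filter_upwards [hF.bayes s, S.ae_stepInput_of_ae_refMeasure s hb',
    S.ae_stepInput_of_ae_ctxLaw s ha, S.ae_marginalDensity_ne_top s,
    S.ae_stepInput_of_ae_ctxLaw s (hR.marginalDensity_pos s.succ), hF.ae_lintegral_rho s]
    with q hbayes hbq haq hfin hpos hint
  filter_upwards [hbayes, hbq, haq] with y hy hby hay
  set V := (volume : Measure (Vec D)) (Metric.closedBall 0 (r s / 2)) with hV
  have hV0 : V ≠ 0 := (Metric.measure_closedBall_pos _ _ (half_pos (hR.side_pos s))).ne'
  have hVt : V ≠ ∞ := measure_closedBall_lt_top.ne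
  have hball : volume (Metric.closedBall (ctr y) (r s / 2)) = V :=
    Measure.addHaar_closedBall_center _ _ _
  set e := ENNReal.ofReal (Real.exp (a y + b y q.2)) with he
  have hρm : Measurable fun w => (F.rho s (F.phi s q) w : ℝ≥0∞) :=
    ((F.measurable_rho_comp s).comp measurable_prodMk_left).coe_nnreal_ennreal
  have hw : ∀ᵐ w ∂(volume.restrict (Metric.closedBall (ctr y) (r s / 2))),
      (F.rho s (F.phi s q) y : ℝ≥0∞) ≤ e * F.rho s (F.phi s q) w := by
    filter_upwards [ae_restrict_of_ae hbayes,
      ae_restrict_mem Metric.isClosed_closedBall.measurableSet] with w hw hmem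
    have hcube := closedBall_subset_closedCube (ctr y) (le_refl (r s / 2)) hmem
    have h1 := mul_le_mul' (le_mul_of_log_div_iInf_le hay hcube)
      (le_mul_of_log_div_iInf_le hby hcube)
    rw [← hy, mul_mul_mul_comm, ← ENNReal.ofReal_mul (Real.exp_nonneg _), ← Real.exp_add, ← he,
      ← hw, mul_left_comm] at h1
    exact (ENNReal.mul_le_mul_iff_right (hpos q.2) hfin).1 h1
  have h2 : (F.rho s (F.phi s q) y : ℝ≥0∞) * V ≤ e := by
    calc (F.rho s (F.phi s q) y : ℝ≥0∞) * V
        = ∫⁻ _w in Metric.closedBall (ctr y) (r s / 2), (F.rho s (F.phi s q) y : ℝ≥0∞) := by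
          rw [setLIntegral_const, hball]
      _ ≤ ∫⁻ w in Metric.closedBall (ctr y) (r s / 2), e * F.rho s (F.phi s q) w :=
          lintegral_mono_ae hw
      _ ≤ ∫⁻ w, e * F.rho s (F.phi s q) w := setLIntegral_le_lintegral _ _
      _ = e := by rw [lintegral_const_mul _ hρm, hint, mul_one]
  have hVr : 0 < V.toReal := ENNReal.toReal_pos hV0 hVt
  have h3 := ENNReal.toReal_mono ENNReal.ofReal_ne_top h2
  rw [ENNReal.toReal_mul, ENNReal.coe_toReal, ENNReal.toReal_ofReal (Real.exp_nonneg _)] at h3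
  exact (le_div_iff₀ hVr).2 h3

end FeatureAssumption

end ReverseDensity

/-! ### Approximation of one reverse step -/

section OneStep

variable {C : Type*} [MeasurableSpace C] {D T : ℕ} {S : DiffusionProblem C D T}
  {F : FeatureData C D T} {r : Fin T → ℝ} {A : (s : Fin T) → PartitionData D (r s)}

namespace FeatureAssumption

theorem ae_stepJoint_of_ae_stepInput (hF : FeatureAssumption S F) (s : Fin T)
    {p : C × Vec D × Vec D → Prop} (hp : MeasurableSet {x | p x})
    (h : ∀ᵐ q ∂S.stepInput s, ∀ᵐ y, p (q.1, y, q.2)) : ∀ᵐ x ∂S.stepJoint s, p x := by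
  have hind : Measurable ({x | p x}ᶜ.indicator (1 : C × Vec D × Vec D → ℝ≥0∞)) :=
    measurable_one.indicator hp.compl
  change S.stepJoint s {x | p x}ᶜ = 0
  rw [← lintegral_indicator_one hp.compl, hF.lintegral_stepJoint s hind]
  refine lintegral_eq_zero_of_ae_eq_zero ?_
  filter_upwards [h] with q hq
  refine lintegral_eq_zero_of_ae_eq_zero ?_
  filter_upwards [hq] with y hy
  simp [hy]

theorem ae_integrable_rho (hF : FeatureAssumption S F) (s : Fin T) :
    ∀ᵐ q ∂S.stepInput s, Integrable (fun y => (F.rho s (F.phi s q) y : ℝ)) ∧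
      ∫ y, (F.rho s (F.phi s q) y : ℝ) = 1 := by
  filter_upwards [hF.ae_lintegral_rho s] with q hq
  have hm : Measurable fun y => (F.rho s (F.phi s q) y : ℝ) :=
    ((F.measurable_rho_comp s).comp measurable_prodMk_left).coe_nnreal_real
  have h : ∫ y, (F.rho s (F.phi s q) y : ℝ) = 1 := by
    rw [integral_eq_lintegral_of_nonneg_ae (ae_of_all _ fun y => NNReal.coe_nonneg _)
      hm.aestronglyMeasurable]
    simp only [ENNReal.ofReal_coe_nnreal, hq, ENNReal.toReal_one]
  exact ⟨.of_integral_ne_zero (by rw [h]; exact one_ne_zero), h⟩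

end FeatureAssumption

theorem measurable_mixtureDensity_net (F : FeatureData C D T) (s : Fin T) {r₀ : ℝ}
    (B : PartitionData D r₀) {m : ℕ} (a : ReLUNet (F.dim s) m) :
    Measurable fun z : (C × Vec D) × Vec D =>
      mixtureDensity B m (a.eval fun i => F.phi s z.1 i) z.2 := by
  have h1 : Measurable fun z : (C × Vec D) × Vec D => a.eval fun i => F.phi s z.1 i := by
    refine a.measurable_eval.comp ?_
    have := F.measurable_phi s
    fun_prop
  have h2 (j : Fin m) : Measurable fun z : (C × Vec D) × Vec D =>
      (a.eval fun i => F.phi s z.1 i) j := (measurable_pi_apply j).comp h1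
  simp only [mixtureDensity, gaussianDensity]
  fun_prop

theorem mixtureDensity_pos {r₀ : ℝ} (B : PartitionData D r₀) (m : ℕ) (u : Fin m → ℝ) (y : Vec D) :
    0 < mixtureDensity B m u y := by
  have h0 : (0 : ℝ) < 1 + ∑ k, Real.exp (u k) := by positivity
  unfold mixtureDensity
  exact add_pos_of_nonneg_of_pos
    (Finset.sum_nonneg fun j _ => mul_nonneg (by positivity) (gaussianDensity_nonneg _ _ _))
    (mul_pos (by positivity) (gaussianDensity_pos _ B.σ0_pos y))

/-- The positive part of the log-likelihood ratio between the reverse density and the mixture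
computed by the network `a`, as a function of `(c, x_s, x_{s+1})`. -/
noncomputable def logRatio (F : FeatureData C D T) (A : (s : Fin T) → PartitionData D (r s))
    (s : Fin T) {m : ℕ} (a : ReLUNet (F.dim s) m) (p : C × Vec D × Vec D) : ℝ≥0∞ :=
  ENNReal.ofReal (Real.log ((F.rho s (F.phi s (p.1, p.2.2)) p.2.1 : ℝ) /
    mixtureDensity (A s) m (a.eval fun i => F.phi s (p.1, p.2.2) i) p.2.1))

theorem measurable_logRatio (F : FeatureData C D T) (A : (s : Fin T) → PartitionData D (r s))
    (s : Fin T) {m : ℕ} (a : ReLUNet (F.dim s) m) : Measurable (logRatio F A s a) := by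
  have h := (measurable_mixtureDensity_net F s (A s) a).comp
    (by fun_prop : Measurable fun p : C × Vec D × Vec D => ((p.1, p.2.2), p.2.1))
  exact ((F.measurable_rho_step s).coe_nnreal_real.div h).log.ennreal_ofReal

/-- One-step divergence of a neural reverse kernel from the true one. -/
theorem klDiv_neuralKernel_le (hF : FeatureAssumption S F) (N : NeuralModel F.dim) (s : Fin T) :
    InformationTheory.klDiv (S.stepInput s ⊗ₘ S.trueReverse s)
        (S.stepInput s ⊗ₘ neuralKernel F A N s) ≤
      ∫⁻ p, logRatio F A s (N.net s) p ∂(S.stepJoint s) := by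
  let f : (C × Vec D) × Vec D → ℝ := fun z => F.rho s (F.phi s z.1) z.2
  let g : (C × Vec D) × Vec D → ℝ := fun z =>
    mixtureDensity (A s) (N.m s) ((N.net s).eval fun i => F.phi s z.1 i) z.2
  have hf : Measurable f := (F.measurable_rho_comp s).coe_nnreal_real
  have hg : Measurable g := measurable_mixtureDensity_net F s (A s) (N.net s)
  let m := S.stepInput s ⊗ₘ Kernel.const (C × Vec D) (volume : Measure (Vec D))
  have e1 : S.stepInput s ⊗ₘ S.trueReverse s = m.withDensity fun z => ENNReal.ofReal (f z) := by
    have hρ : Measurable (Function.uncurry fun q y => (F.rho s (F.phi s q) y : ℝ≥0∞)) :=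
      (F.measurable_rho_comp s).coe_nnreal_ennreal
    have hae : S.trueReverse s =ᵐ[S.stepInput s] Kernel.withDensity
        (Kernel.const (C × Vec D) volume) fun q y => (F.rho s (F.phi s q) y : ℝ≥0∞) := by
      filter_upwards [hF.sufficiency s] with q hq
      rw [hq, Kernel.withDensity_apply _ hρ, Kernel.const_apply]
    rw [Measure.compProd_congr hae, Measure.compProd_withDensity hρ]
    simp only [f, m, ENNReal.ofReal_coe_nnreal]
  have e2 : S.stepInput s ⊗ₘ neuralKernel F A N s = m.withDensity fun z => ENNReal.ofReal (g z) := by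
    have hM := isMarkovKernel_neuralKernel F A N s
    unfold neuralKernel at hM ⊢
    rw [Measure.compProd_withDensity (measurable_neuralDensity F A N s)]
  have h1 : IsProbabilityMeasure (m.withDensity fun z => ENNReal.ofReal (f z)) := by
    rw [← e1]; infer_instance
  have h2 : IsProbabilityMeasure (m.withDensity fun z => ENNReal.ofReal (g z)) := by
    rw [← e2]; infer_instance
  have key := klDiv_withDensity_le hf hg (ae_of_all m fun z => NNReal.coe_nonneg _)
    (ae_of_all m fun z => mixtureDensity_pos _ _ _ _)
  rw [← e1, ← e2, S.stepInput_compProd_trueReverse] at key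
  rw [S.stepInput_compProd_trueReverse]
  refine key.trans_eq ?_
  have hfg : Measurable fun z => ENNReal.ofReal (Real.log (f z / g z)) :=
    (hf.div hg).log.ennreal_ofReal
  rw [DiffusionProblem.reverseJoint, lintegral_map hfg (by fun_prop)]
  rfl

/-- **One-step approximation**.  The reverse kernels are approximated in mean divergence by neural
Gaussian mixtures.  The limit is taken by the reverse Fatou lemma; the domination is uniform in the
number of cells because the target logits keep a fixed weight on the broad Gaussian. -/
theorem exists_net_lintegral_logRatio_le (hD : 1 ≤ D) {k : Fin T → ℕ}
    (hF : FeatureAssumption S F) (hR : RegularityAssumption S r) (hL : SmoothLogOdds F A k)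
    (s : Fin T) {η : ℝ} (hη : 0 < η) :
    ∃ m, 1 ≤ m ∧ ∃ a : ReLUNet (F.dim s) m,
      ∫⁻ p, logRatio F A s a p ∂(S.stepJoint s) ≤ ENNReal.ofReal η := by
  obtain ⟨ε, ⟨hε0, hε1⟩, hεη⟩ : ∃ ε : ℝ, (0 < ε ∧ ε < 1) ∧ 2 * ε - 2 * Real.log (1 - ε) < η := by
    have hc : ContinuousAt (fun ε : ℝ => 2 * ε - 2 * Real.log (1 - ε)) 0 := by
      refine ContinuousAt.sub (by fun_prop) (ContinuousAt.mul continuousAt_const ?_)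
      exact ContinuousAt.log (by fun_prop) (by norm_num)
    have h1 := hc.tendsto.mono_left (nhdsWithin_le_nhds (s := Set.Ioi 0))
    have h2 := h1.eventually (gt_mem_nhds (show 2 * (0 : ℝ) - 2 * Real.log (1 - 0) < η by simpa))
    have h3 : ∀ᶠ ε : ℝ in 𝓝[>] 0, 0 < ε ∧ ε < 1 := Ioo_mem_nhdsGT one_pos
    exact (h3.and h2).exists
  have h1ε : 0 < 1 - ε := by linarith
  choose net hnet using fun n : ℕ => exists_net_liftedLogits (ε := ε) hε0 hε1 hL
    (hF.isCompact_supp s) (m := n + 1) (by omega)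
  obtain ⟨ctr, a, b, -, ha, hb, hlog, hlog', hab⟩ := hR.logVariation s
  -- lower bounds for the mixtures
  have hmix : ∀ᵐ q ∂S.stepInput s, ∀ n y,
      Real.exp (-(2 * ε)) * ((1 - ε) * ∑ j, (∫ u in (A s).cell (n + 1) j,
          (F.rho s (F.phi s q) u : ℝ)) *
          gaussianDensity ((A s).center (n + 1) j) ((A s).σ (n + 1)) y) ≤
        mixtureDensity (A s) (n + 1) ((net n).eval fun i => F.phi s q i) y ∧
      Real.exp (-(2 * ε)) * (ε * gaussianDensity 0 (A s).σ0 y) ≤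
        mixtureDensity (A s) (n + 1) ((net n).eval fun i => F.phi s q i) y := by
    filter_upwards [hF.ae_mem_supp s, hF.ae_integrable_rho s, hF.ae_rho_pos hR s]
      with q hK hint hpos n y
    have h1 := mixtureDensity_liftedLogits_ge (A s) hε0 hε1 hD (m := n + 1) (by omega)
      hint.1 hint.2 hpos y
    have h2 := mixtureDensity_perturb (A s) hε0.le (hnet n _ hK) y
    exact ⟨(mul_le_mul_of_nonneg_left h1.1 (Real.exp_nonneg _)).trans h2,
      (mul_le_mul_of_nonneg_left h1.2 (Real.exp_nonneg _)).trans h2⟩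
  -- the dominating function
  set V := (volume : Measure (Vec D)).real (Metric.closedBall 0 (r s / 2)) with hV
  have hV0 : 0 < V := ENNReal.toReal_pos
    (Metric.measure_closedBall_pos _ _ (half_pos (hR.side_pos s))).ne' measure_closedBall_lt_top.ne
  set κ := (2 * Real.pi * (A s).σ0 ^ 2) ^ (-((D : ℝ) / 2)) with hκ
  have hσ0 := (A s).σ0_pos
  have hκ0 : 0 < κ := by positivity
  set c₀ := Real.log (1 / (V * (Real.exp (-(2 * ε)) * (ε * κ)))) with hc₀
  let G : C × Vec D × Vec D → ℝ≥0∞ := fun p =>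
    ((a p.2.1 : ℝ≥0∞) + (b p.2.1 p.2.2 : ℝ≥0∞)) +
      (ENNReal.ofReal (1 / (2 * (A s).σ0 ^ 2)) * ‖p.2.1‖ₑ ^ 2 + ENNReal.ofReal c₀)
  have hab_m : Measurable fun p : C × Vec D × Vec D =>
      (a p.2.1 : ℝ≥0∞) + (b p.2.1 p.2.2 : ℝ≥0∞) :=
    (ha.comp (by fun_prop)).coe_nnreal_ennreal.add (hb.comp measurable_snd).coe_nnreal_ennreal
  have hG : Measurable G := hab_m.add (by fun_prop)
  have hsq : ∫⁻ p, ‖p.2.1‖ₑ ^ 2 ∂(S.stepJoint s) < ∞ := by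
    rw [S.lintegral_stepJoint_fst s (f := fun _ y => ‖y‖ₑ ^ 2) (by fun_prop)]
    exact hR.secondMoment s
  have hGfin : ∫⁻ p, G p ∂(S.stepJoint s) ≠ ∞ := by
    rw [lintegral_add_left hab_m, lintegral_add_right _ measurable_const, lintegral_const_mul _
      (by fun_prop), lintegral_const, measure_univ, mul_one]
    exact ENNReal.add_ne_top.2 ⟨hab.ne, ENNReal.add_ne_top.2
      ⟨ENNReal.mul_ne_top ENNReal.ofReal_ne_top hsq.ne, ENNReal.ofReal_ne_top⟩⟩
  have hdom (n : ℕ) : logRatio F A s (net n) ≤ᵐ[S.stepJoint s] G := by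
    refine hF.ae_stepJoint_of_ae_stepInput s
      (measurableSet_le (measurable_logRatio F A s (net n)) hG) ?_
    filter_upwards [hmix, hF.rho_le hR s hlog hlog', hF.ae_rho_pos hR s] with q hq hle hpos
    filter_upwards [hle, hpos] with y hy hy0
    have h1 := (hq n y).2
    have hg : Real.exp (-(2 * ε)) * (ε * gaussianDensity 0 (A s).σ0 y) =
        Real.exp (-(2 * ε)) * (ε * κ) * Real.exp (-(‖y‖ ^ 2 / (2 * (A s).σ0 ^ 2))) := by
      rw [gaussianDensity, sub_zero, ← hκ]
      ring
    rw [hg] at h1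
    have hy0' : (0 : ℝ) < F.rho s (F.phi s q) y := NNReal.coe_pos.2 hy0
    have h2 : Real.log ((F.rho s (F.phi s q) y : ℝ) /
        mixtureDensity (A s) (n + 1) ((net n).eval fun i => F.phi s q i) y) ≤
        (a y + b y q.2) + (1 / (2 * (A s).σ0 ^ 2) * ‖y‖ ^ 2 + c₀) := by
      refine (Real.log_le_log (div_pos hy0' (mixtureDensity_pos _ _ _ _))
        (div_le_div₀ (by positivity) hy (by positivity) h1)).trans_eq ?_
      have e : Real.exp (a y + b y q.2) / V / (Real.exp (-(2 * ε)) * (ε * κ) *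
          Real.exp (-(‖y‖ ^ 2 / (2 * (A s).σ0 ^ 2)))) =
          Real.exp (a y + b y q.2) * (Real.exp (1 / (2 * (A s).σ0 ^ 2) * ‖y‖ ^ 2) *
            (1 / (V * (Real.exp (-(2 * ε)) * (ε * κ))))) := by
        rw [Real.exp_neg (‖y‖ ^ 2 / (2 * (A s).σ0 ^ 2)), one_div_mul_eq_div]
        field_simp
      rw [e, Real.log_mul (by positivity) (by positivity), Real.log_mul (by positivity)
        (by positivity), Real.log_exp, Real.log_exp]
    refine (ENNReal.ofReal_le_ofReal h2).trans (ENNReal.ofReal_add_le.trans (add_le_add ?_ ?_))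
    · refine ENNReal.ofReal_add_le.trans_eq ?_
      rw [ENNReal.ofReal_coe_nnreal, ENNReal.ofReal_coe_nnreal]
    · refine ENNReal.ofReal_add_le.trans_eq ?_
      rw [ENNReal.ofReal_mul (by positivity), ENNReal.ofReal_pow (norm_nonneg _), ofReal_norm]
  -- the pointwise limit
  have hlim : ∀ᵐ p ∂S.stepJoint s, limsup (fun n => logRatio F A s (net n) p) atTop ≤
      ENNReal.ofReal (2 * ε - 2 * Real.log (1 - ε)) := by
    refine hF.ae_stepJoint_of_ae_stepInput s (measurableSet_le
      (Measurable.limsup fun n => measurable_logRatio F A s (net n)) measurable_const) ?_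
    filter_upwards [hmix, hF.ae_integrable_rho s, hF.ae_rho_pos hR s] with q hq hint hpos
    filter_upwards [(A s).ae_eventually_le_mixture hD hint.1 (fun u => NNReal.coe_nonneg _), hpos]
      with y hy hy0
    have hy0' : (0 : ℝ) < F.rho s (F.phi s q) y := NNReal.coe_pos.2 hy0
    refine limsup_le_of_le (by isBoundedDefault) ?_
    filter_upwards [(tendsto_add_atTop_nat 1).eventually (hy (1 - ε) (by linarith))] with n hn
    have h1 : Real.exp (-(2 * ε)) * ((1 - ε) * ((1 - ε) * F.rho s (F.phi s q) y)) ≤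
        mixtureDensity (A s) (n + 1) ((net n).eval fun i => F.phi s q i) y :=
      (mul_le_mul_of_nonneg_left (mul_le_mul_of_nonneg_left hn h1ε.le)
        (Real.exp_nonneg _)).trans (hq n y).1
    refine ENNReal.ofReal_le_ofReal ?_
    refine (Real.log_le_log (div_pos hy0' (mixtureDensity_pos _ _ _ _))
      (div_le_div_of_nonneg_left hy0'.le (by positivity) h1)).trans_eq ?_
    have e : (F.rho s (F.phi s q) y : ℝ) /
        (Real.exp (-(2 * ε)) * ((1 - ε) * ((1 - ε) * F.rho s (F.phi s q) y))) =
        Real.exp (2 * ε) / (1 - ε) ^ 2 := by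
      rw [Real.exp_neg]
      field_simp
    rw [e, Real.log_div (by positivity) (by positivity), Real.log_exp, Real.log_pow]
    push_cast
    ring
  have hfatou := limsup_lintegral_le (μ := S.stepJoint s) G
    (fun n => measurable_logRatio F A s (net n)) hdom hGfin
  have hlt : limsup (fun n => ∫⁻ p, logRatio F A s (net n) p ∂(S.stepJoint s)) atTop <
      ENNReal.ofReal η := by
    refine (hfatou.trans (lintegral_mono_ae hlim)).trans_lt ?_
    rw [lintegral_const, measure_univ, mul_one]
    exact (ENNReal.ofReal_lt_ofReal_iff hη).2 hεη
  obtain ⟨n, hn⟩ := (eventually_lt_of_limsup_lt hlt).exists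
  exact ⟨n + 1, by omega, net n, hn.le⟩

/-- Neural models with arbitrarily small mean error. -/
theorem exists_neuralModel_outputKL_le (hD : 1 ≤ D) {k : Fin T → ℕ}
    (hF : FeatureAssumption S F) (hR : RegularityAssumption S r) (hL : SmoothLogOdds F A k)
    (hM : S.ExactTerminalMatching) {η : ℝ} (hη : 0 < η) :
    ∃ N : NeuralModel F.dim, S.outputKL (neuralPredictor S F A N) ≤ ENNReal.ofReal η := by
  have hT : (0 : ℝ) < T + 1 := by positivity
  choose m hm a ha using fun s =>
    exists_net_lintegral_logRatio_le hD hF hR hL s (div_pos hη hT)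
  let N : NeuralModel F.dim := ⟨m, hm, a⟩
  refine ⟨N, ?_⟩
  have hlast : S.ctxLaw ⊗ₘ S.fwdMarginal (Fin.last T) = S.ctxLaw ⊗ₘ Kernel.const C S.ref :=
    Measure.compProd_congr hM
  have h1 := klDiv_predictor_le S.ctxLaw S.ref T S.fwdMarginal S.trueReverse (neuralKernel F A N)
    (fun s => S.compProd_fwdMarginal_castSucc s) hlast
  rw [S.fwdMarginal_zero] at h1
  refine ((lintegral_klDiv_le S.ctxLaw S.target _).trans h1).trans ?_
  calc ∑ s, InformationTheory.klDiv ((S.ctxLaw ⊗ₘ S.fwdMarginal s.succ) ⊗ₘ S.trueReverse s)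
        ((S.ctxLaw ⊗ₘ S.fwdMarginal s.succ) ⊗ₘ neuralKernel F A N s)
      ≤ ∑ _s : Fin T, ENNReal.ofReal (η / (T + 1)) := by
        refine Finset.sum_le_sum fun s _ => ?_
        rw [← S.stepInput_eq]
        exact (klDiv_neuralKernel_le hF N s).trans (ha s)
    _ = ENNReal.ofReal (T * (η / (T + 1))) := by
        rw [Finset.sum_const, Finset.card_univ, Fintype.card_fin, nsmul_eq_mul,
          ENNReal.ofReal_mul (Nat.cast_nonneg T), ENNReal.ofReal_natCast]
    _ ≤ ENNReal.ofReal η := by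
        refine ENNReal.ofReal_le_ofReal ?_
        rw [mul_div_assoc', div_le_iff₀ hT]
        nlinarith

end OneStep

end CondDiffusion

theorem corollary4p4 {C : Type*} [MeasurableSpace C] [StandardBorelSpace C]
    {D T : ℕ} (hD : 1 ≤ D) (hT : 1 ≤ T)
    (S : DiffusionProblem C D T) (F : FeatureData C D T) (r : Fin T → ℝ)
    (A : (s : Fin T) → PartitionData D (r s)) (k : Fin T → ℕ)
    (hF : FeatureAssumption S F) (hR : RegularityAssumption S r)
    (hL : SmoothLogOdds F A k) (hM : S.ExactTerminalMatching) :
    -- for all `η, δ > 0` some neural model has error at most `η` with probability `≥ 1 - δ`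
    (∀ η δ : ℝ, 0 < η → 0 < δ → ∃ N : NeuralModel F.dim,
      S.ctxLaw {c | ENNReal.ofReal η <
        InformationTheory.klDiv (S.target c) (neuralPredictor S F A N c)}
        ≤ ENNReal.ofReal δ) ∧
    -- there are sequences of neural models with mean error tending to zero, and each of them has a
    -- subsequence whose error tends to zero for almost every context
    (∃ N : ℕ → NeuralModel F.dim,
      Tendsto (fun n => S.outputKL (neuralPredictor S F A (N n))) atTop (𝓝 0)) ∧
    (∀ N : ℕ → NeuralModel F.dim,
      Tendsto (fun n => S.outputKL (neuralPredictor S F A (N n))) atTop (𝓝 0) →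
      ∃ n : ℕ → ℕ, StrictMono n ∧ ∀ᵐ c ∂S.ctxLaw,
        Tendsto (fun i => InformationTheory.klDiv (S.target c)
          (neuralPredictor S F A (N (n i)) c)) atTop (𝓝 0)) := by
  have hmeas (N : NeuralModel F.dim) : Measurable fun c =>
      InformationTheory.klDiv (S.target c) (neuralPredictor S F A N c) :=
    measurable_klDiv_kernel S.target (predictor S.ref T (neuralKernel F A N))
  refine ⟨fun η δ hη hδ => ?_, ?_, fun N hN => ?_⟩
  · obtain ⟨N, hN⟩ := exists_neuralModel_outputKL_le hD hF hR hL hM (mul_pos hη hδ)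
    refine ⟨N, ?_⟩
    have h0 : ENNReal.ofReal η ≠ 0 := (ENNReal.ofReal_pos.2 hη).ne'
    have h1 := (mul_meas_ge_le_lintegral (μ := S.ctxLaw) (hmeas N) (ENNReal.ofReal η)).trans hN
    rw [ENNReal.ofReal_mul hη.le, ENNReal.mul_le_mul_iff_right h0 ENNReal.ofReal_ne_top] at h1
    exact (measure_mono fun c (hc : ENNReal.ofReal η < _) => hc.le).trans h1
  · choose N hN using fun n : ℕ => exists_neuralModel_outputKL_le hD hF hR hL hM
      (show (0 : ℝ) < 1 / (n + 1) by positivity)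
    refine ⟨N, tendsto_of_tendsto_of_tendsto_of_le_of_le tendsto_const_nhds ?_
      (fun n => zero_le) hN⟩
    simpa using ENNReal.tendsto_ofReal tendsto_one_div_add_atTop_nhds_zero_nat
  · exact exists_strictMono_ae_tendsto_zero (fun n => hmeas (N n)) hN
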